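/- Let $d,m\in\mathbb N$, let $\Psi_0\in\mathbb R^{m\times(d+m)}$ and $\Psi_1\in\mathbb R^{d\times(d+m)}$ be such that $\Sigma_0=\Psi_0\Psi_0^\top$ and $\Sigma_1=\Psi_1\Psi_1^\top$ are positive definite, and let $\alpha\in\mathbb R^d$, $\eta\in\mathbb R^m$, $(\mu^i)\in\mathbb R^d$, $\delta^i>0$ $(1\le i\le d)$, $r\ge 0$. These are the parameters of the co-integrated market $$\frac{dF_t}{F_t}=\eta\,dt+\Psi_0\,dB_t,\qquad \frac{dS^i_t}{S^i_t}=(\mu^i-\delta^iZ^i_t)\,dt+(\Psi_1\,dB_t)^i,\qquad \frac{dS^i_t}{S^i_t}=\alpha^i\,dt+\sum_j\beta^{ij}\frac{dF^j_t}{F^j_t}+dZ^i_t .$$ Put $\beta=\Psi_1\Psi_0^\top\Sigma_0^{-1}$, $\mu=(\mu^i-r)_i$, $\delta=\mathrm{diag}(\delta^i)$, $\theta^i=(-\alpha^i-\sum_j\beta^{ij}\eta^j+\mu^i)/\delta^i$ (with the drift $\mu^i$), $\Sigma_2=\Sigma_1-\Psi_1\Psi_0^\top\beta^\top$ and $\Sigma_3=\Sigma_1-\Psi_1\Psi_0^\top\beta^\top-\beta\Psi_0\Psi_1^\top+\beta\Sigma_0\beta^\top$.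 Let $\gamma<0$ and $U(w)=\frac1\gamma w^\gamma$ for $w>0$. For $b\in\mathbb R^d$, $C\in\mathbb R^{d\times d}$ let $$\begin{aligned}L(b,C)=&-b^\top\Big(\tfrac{\gamma}{2(1-\gamma)}\Sigma_2^\top\Sigma_1^{-1}\Sigma_2+\tfrac12\Sigma_3\Big)b-\tfrac{\gamma}{2(1-\gamma)}b^\top\Sigma_2^\top\Sigma_1^{-1}\mu-\tfrac{\gamma}{2(1-\gamma)}\mu^\top\Sigma_1^{-1}\Sigma_2b\\&-\theta^\top\delta b-\tfrac{\gamma}{2(1-\gamma)}\mu^\top\Sigma_1^{-1}\mu-\mathrm{tr}(\Sigma_3C)-r\gamma .\end{aligned}$$ For $T\in\mathbb R$ consider on $(-\infty,T]$ the system $$\begin{aligned}a'&=L(b,C),\qquad a(T)=0,\\ b'&=-C\Big(\tfrac{2\gamma}{1-\gamma}\Sigma_2^\top\Sigma_1^{-1}\Sigma_2+2\Sigma_3\Big)b+\Big(\tfrac{\gamma}{1-\gamma}\delta\Sigma_1^{-1}\Sigma_2+\delta\Big)b-C\Big(\tfrac{2\gamma}{1-\gamma}\Sigma_2^\top\Sigma_1^{-1}\mu+2\delta\theta\Big)+\tfrac{\gamma}{1-\gamma}\delta\Sigma_1^{-1}\mu,\quad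 b(T)=0,\\ C'&=-C\Big(\tfrac{2\gamma}{1-\gamma}\Sigma_2^\top\Sigma_1^{-1}\Sigma_2+2\Sigma_3\Big)C+C\Big(\tfrac{\gamma}{1-\gamma}\Sigma_2^\top\Sigma_1^{-1}\delta+\delta\Big)+\Big(\tfrac{\gamma}{1-\gamma}\Sigma_2^\top\Sigma_1^{-1}\delta+\delta\Big)^\top C-\tfrac{\gamma}{2(1-\gamma)}\delta\Sigma_1^{-1}\delta,\quad C(T)=0 .\end{aligned}$$ Then for every $T$ this system has a unique solution $(a,b,C)=(a_T,b_T,C_T)$ on $(-\infty,T]$, and the function $u(t,w,z)=u_T(t,w,z)=\frac1\gamma w^\gamma\exp\big(a(t)+b(t)^\top z+z^\top C(t)z\big)$ is a classical solution, for $t\le T$, $w>0$, $z\in\mathbb R^d$, of the Hamilton–Jacobi–Bellman equation of the unconstrained problem of maximising the expected utility $U$ of terminal wealth, $$-u_t-(\theta-z)^\top\delta\nabla_zu-\tfrac12\mathrm{tr}(\Sigma_3\nabla_z^2u)-rwu_w-\sup_{\pi\in\mathbb R^d}\Big(\pi^\top(\mu-\delta z)wu_w+\pi^\top\Sigma_2\nabla_zu_w\,w+\tfrac12\pi^\top\Sigma_1\pi\,w^2u_{ww}\Big)=0,\qquad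 u(T,w,z)=U(w).$$ Moreover there are $\bar b\in\mathbb R^d$ and $\bar C\in\mathbb R^{d\times d}$, not depending on $T$, such that with $\bar L=L(\bar b,\bar C)$, for every $T$, as $t\to-\infty$, $$b_T(t)\to\bar b,\qquad C_T(t)\to\bar C,\qquad L(b_T(t),C_T(t))\to\bar L,\qquad \frac{a_T(t)}{T-t}\to-\bar L .$$ Consequently the long-term growth rate of the certainty equivalent $U^{-1}(u)$ is a constant: for all $w>0$ and $z\in\mathbb R^d$, $$\lim_{t\to-\infty}\frac{\ln U^{-1}(u_T(t,w,z))}{T-t}=-\frac{\bar L}{\gamma}\ \text{ for every } T,\qquad \lim_{T\to\infty}\frac{\ln U^{-1}(u_T(t,w,z))}{T-t}=-\frac{\bar L}{\gamma}\ \text{ for every } t.$$ -/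

import Mathlib

open Filter Set
open scoped Topology Matrix

noncomputable section

/-- Parameters of the co-integrated market with `d` stocks and `m` factors, driven by `d + m`
independent Brownian motions:
`dF/F = η dt + Ψ₀ dB`,  `dS/S = (μ - δ Z) dt + Ψ₁ dB`,  `dS/S = α dt + β dF/F + dZ`,
with interest rate `r`. -/
structure CointegratedMarket (d m : ℕ) where
  /-- systemic returns `α` of the stocks after controlling for the factors -/
  alpha : Fin d → ℝ
  /-- factor drifts `η` -/
  eta : Fin m → ℝ
  /-- stock drifts `μ` (the excess drift `μ - r` is `muEx`) -/
  drift : Fin d → ℝ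
  /-- mean reversion speeds `δ` -/
  speed : Fin d → ℝ
  /-- factor diffusion coefficients `Ψ₀` -/
  Psi0 : Matrix (Fin m) (Fin (d + m)) ℝ
  /-- stock diffusion coefficients `Ψ₁` -/
  Psi1 : Matrix (Fin d) (Fin (d + m)) ℝ
  /-- risk-free rate -/
  r : ℝ
  r_nonneg : 0 ≤ r
  speed_pos : ∀ i, 0 < speed i
  posDef0 : (Psi0 * Psi0ᵀ).PosDef
  posDef1 : (Psi1 * Psi1ᵀ).PosDef

namespace CointegratedMarket

variable {d m : ℕ} (M : CointegratedMarket d m)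

/-- `Σ₀ = Ψ₀ Ψ₀ᵀ`. -/
def Sigma0 : Matrix (Fin m) (Fin m) ℝ := M.Psi0 * M.Psi0ᵀ

/-- `Σ₁ = Ψ₁ Ψ₁ᵀ`. -/
def Sigma1 : Matrix (Fin d) (Fin d) ℝ := M.Psi1 * M.Psi1ᵀ

/-- The factor loadings `β = Ψ₁ Ψ₀ᵀ Σ₀⁻¹`. -/
def beta : Matrix (Fin d) (Fin m) ℝ := M.Psi1 * M.Psi0ᵀ * M.Sigma0⁻¹

/-- `Σ₂ = Σ₁ - Ψ₁ Ψ₀ᵀ βᵀ`. -/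
def Sigma2 : Matrix (Fin d) (Fin d) ℝ := M.Sigma1 - M.Psi1 * M.Psi0ᵀ * M.betaᵀ

/-- `Σ₃ = Σ₁ - Ψ₁ Ψ₀ᵀ βᵀ - β Ψ₀ Ψ₁ᵀ + β Σ₀ βᵀ`. -/
def Sigma3 : Matrix (Fin d) (Fin d) ℝ :=
  M.Sigma1 - M.Psi1 * M.Psi0ᵀ * M.betaᵀ - M.beta * M.Psi0 * M.Psi1ᵀ + M.beta * M.Sigma0 * M.betaᵀ

/-- The vector of excess drifts `μⁱ - r`. -/
def muEx : Fin d → ℝ := fun i => M.drift i - M.r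

/-- The diagonal matrix `δ` of mean reversion speeds. -/
def delta : Matrix (Fin d) (Fin d) ℝ := Matrix.diagonal M.speed

/-- The stationary means `θⁱ = (-αⁱ - ∑ⱼ βⁱʲ ηʲ + μⁱ) / δⁱ` of the spreads. -/
def theta : Fin d → ℝ :=
  fun i => (-M.alpha i - ∑ j, M.beta i j * M.eta j + M.drift i) / M.speed i

/-- The right-hand side `L` of the scalar equation `da/dt = L(b, C)`. -/
def rhsA (γ : ℝ) (b : Fin d → ℝ) (C : Matrix (Fin d) (Fin d) ℝ) : ℝ :=
  -(b ⬝ᵥ ((γ / (2 * (1 - γ))) • (M.Sigma2ᵀ * M.Sigma1⁻¹ * M.Sigma2)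
        + (1 / 2 : ℝ) • M.Sigma3) *ᵥ b)
    - γ / (2 * (1 - γ)) * (b ⬝ᵥ (M.Sigma2ᵀ * M.Sigma1⁻¹) *ᵥ M.muEx)
    - γ / (2 * (1 - γ)) * (M.muEx ⬝ᵥ (M.Sigma1⁻¹ * M.Sigma2) *ᵥ b)
    - M.theta ⬝ᵥ M.delta *ᵥ b
    - γ / (2 * (1 - γ)) * (M.muEx ⬝ᵥ M.Sigma1⁻¹ *ᵥ M.muEx)
    - (M.Sigma3 * C).trace - M.r * γ

/-- The right-hand side of the linear equation for `b`. -/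
def rhsB (γ : ℝ) (b : Fin d → ℝ) (C : Matrix (Fin d) (Fin d) ℝ) : Fin d → ℝ :=
  -((C * ((2 * γ / (1 - γ)) • (M.Sigma2ᵀ * M.Sigma1⁻¹ * M.Sigma2) + (2 : ℝ) • M.Sigma3)) *ᵥ b)
    + ((γ / (1 - γ)) • (M.delta * M.Sigma1⁻¹ * M.Sigma2) + M.delta) *ᵥ b
    - C *ᵥ ((2 * γ / (1 - γ)) • ((M.Sigma2ᵀ * M.Sigma1⁻¹) *ᵥ M.muEx)
        + (2 : ℝ) • (M.delta *ᵥ M.theta))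
    + (γ / (1 - γ)) • ((M.delta * M.Sigma1⁻¹) *ᵥ M.muEx)

/-- The right-hand side of the matrix Riccati equation for `C`. -/
def rhsC (γ : ℝ) (C : Matrix (Fin d) (Fin d) ℝ) : Matrix (Fin d) (Fin d) ℝ :=
  -(C * ((2 * γ / (1 - γ)) • (M.Sigma2ᵀ * M.Sigma1⁻¹ * M.Sigma2) + (2 : ℝ) • M.Sigma3) * C)
    + C * ((γ / (1 - γ)) • (M.Sigma2ᵀ * M.Sigma1⁻¹ * M.delta) + M.delta)
    + ((γ / (1 - γ)) • (M.Sigma2ᵀ * M.Sigma1⁻¹ * M.delta) + M.delta)ᵀ * C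
    - (γ / (2 * (1 - γ))) • (M.delta * M.Sigma1⁻¹ * M.delta)

/-- `(a, b, C)` solves the terminal value problem for the system of ordinary differential equations
on `(-∞, T]` (the derivative at `T` is one-sided, that of `C` is taken entrywise). -/
structure SolvesODE (γ T : ℝ) (a : ℝ → ℝ) (b : ℝ → Fin d → ℝ)
    (C : ℝ → Matrix (Fin d) (Fin d) ℝ) : Prop where
  deriv_a : ∀ t ≤ T, HasDerivWithinAt a (M.rhsA γ (b t) (C t)) (Iic T) t
  terminal_a : a T = 0
  deriv_b : ∀ t ≤ T, HasDerivWithinAt b (M.rhsB γ (b t) (C t)) (Iic T) t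
  terminal_b : b T = 0
  deriv_C : ∀ t ≤ T, ∀ i j, HasDerivWithinAt (fun s => C s i j) (M.rhsC γ (C t) i j) (Iic T) t
  terminal_C : C T = 0

end CointegratedMarket

/-- Power utility `U(w) = w ^ γ / γ`, used for `w > 0`. -/
def powerUtility (γ w : ℝ) : ℝ := 1 / γ * w ^ γ

/-- The inverse `U⁻¹` of power utility on the half-line `w > 0`. -/
def powerUtilityInv (γ : ℝ) : ℝ → ℝ := Function.invFunOn (powerUtility γ) (Ioi 0)

/-- `u(t, w, z) = (w ^ γ / γ) exp (a(t) + b(t)ᵀ z + zᵀ C(t) z)`. -/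
def expQuadValue {d : ℕ} (γ : ℝ) (a : ℝ → ℝ) (b : ℝ → Fin d → ℝ)
    (C : ℝ → Matrix (Fin d) (Fin d) ℝ) (t w : ℝ) (z : Fin d → ℝ) : ℝ :=
  1 / γ * w ^ γ * Real.exp (a t + b t ⬝ᵥ z + z ⬝ᵥ C t *ᵥ z)

/-- Gradient in coordinates. -/
def gradZ {d : ℕ} (f : (Fin d → ℝ) → ℝ) (z : Fin d → ℝ) : Fin d → ℝ :=
  fun i => fderiv ℝ f z (Pi.single i 1)

/-- Hessian matrix in coordinates. -/
def hessZ {d : ℕ} (f : (Fin d → ℝ) → ℝ) (z : Fin d → ℝ) : Matrix (Fin d) (Fin d) ℝ :=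
  Matrix.of fun i j => gradZ (fun y => gradZ f y j) z i

/-- `u(t, w, z)` is a classical solution on `t ≤ T`, `w > 0`, `z ∈ ℝᵈ` of the
Hamilton-Jacobi-Bellman equation of the unconstrained problem of maximising the expected utility of
terminal wealth,
`-u_t - (θ - z)ᵀ δ ∇u - tr(Σ₃ ∇²u) / 2 - r w u_w
  - sup_π (πᵀ (μ - δ z) w u_w + πᵀ Σ₂ ∇u_w w + πᵀ Σ₁ π w² u_ww / 2) = 0`,
with terminal value `U(w)`. The equation says that the supremum is finite and equal to the
remaining terms. -/
structure CointegratedMarket.SolvesHJB {d m : ℕ} (M : CointegratedMarket d m) (γ T : ℝ)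
    (u : ℝ → ℝ → (Fin d → ℝ) → ℝ) : Prop where
  diff_time : ∀ w > 0, ∀ z, DifferentiableOn ℝ (fun s => u s w z) (Iic T)
  contDiff_space : ∀ t ≤ T, ContDiffOn ℝ 2 (fun p : ℝ × (Fin d → ℝ) => u t p.1 p.2)
    (Ioi 0 ×ˢ univ)
  equation : ∀ t ≤ T, ∀ w > 0, ∀ z : Fin d → ℝ,
    IsLUB (range fun π : Fin d → ℝ =>
        π ⬝ᵥ (M.muEx - M.delta *ᵥ z) * (w * deriv (fun x => u t x z) w)
        + (π ⬝ᵥ M.Sigma2 *ᵥ gradZ (fun y => deriv (fun x => u t x y) w) z) * w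
        + 1 / 2 * (π ⬝ᵥ M.Sigma1 *ᵥ π) * w ^ 2 * iteratedDeriv 2 (fun x => u t x z) w)
      (-derivWithin (fun s => u s w z) (Iic T) t
        - (M.theta - z) ⬝ᵥ M.delta *ᵥ gradZ (fun y => u t w y) z
        - 1 / 2 * (M.Sigma3 * hessZ (fun y => u t w y) z).trace
        - M.r * w * deriv (fun x => u t x z) w)
  terminal : ∀ w > 0, ∀ z, u T w z = powerUtility γ w

end

/-! Put `τ = T - t` and `X = -C`. The system is autonomous, so one flow started at zero serves every
horizon, and `C` becomes a Riccati flow `X' = q - Aᵀ X - X A - X R X`.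

The sign of `γ` and `0 ≤ Σ₂ = Σ₃ ≤ Σ₁` make `R` positive semidefinite and `q` positive definite
(`riccatiR_posSemidef`, `riccatiQ_posDef`). The linear Hamiltonian system for `(U, V)` gives `X = V
U⁻¹`. Monotonicity of `(U v) ⬝ᵥ (V v)` keeps `U` invertible, so `X` exists for all `τ ≥ 0` and is
positive semidefinite. A conserved quantity gives `Uᵀ X' U = q`, so `X` increases
(`exists_riccati_solution`). It is bounded because some feedback turns `A` into `diag δ`
(`exists_stabilizing_feedback`, `diag_le_of_riccatiField_posSemidef`). Its limit `Y` is an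
equilibrium and defines a quadratic Lyapunov function for the limiting linear equation of `b`, so
`b` converges as well (`tendsto_of_lyapunov`). Then `a' = -L` converges in `τ`, and `a / τ` has the
same limit.

For the Hamilton-Jacobi-Bellman equation, the supremum is that of a concave quadratic. After
division by `u`, the equation is an algebraic identity in `z` (`reduced_hjb`). The logarithm of the
certainty equivalent is `ln w` plus the exponent of `u` over `γ`, and only `a` in it grows with `τ`.
-/

/-! ### Matrix calculus and the linear Hamiltonian system -/

section MatrixCalculus

attribute [local instance] Matrix.linftyOpNormedRing Matrix.linftyOpNormedAlgebra

variable {d : ℕ}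

/-- Bridges the entrywise derivatives of the system and derivatives in the normed algebra of
matrices, where product and inverse rules apply. -/
theorem hasDerivWithinAt_matrix_iff {P : ℝ → Matrix (Fin d) (Fin d) ℝ}
    {P' : Matrix (Fin d) (Fin d) ℝ} {s : Set ℝ} {t : ℝ} :
    HasDerivWithinAt P P' s t ↔ ∀ i j, HasDerivWithinAt (fun s => P s i j) (P' i j) s t := by
  let e : Matrix (Fin d) (Fin d) ℝ ≃L[ℝ] (Fin d → Fin d → ℝ) :=
    (LinearEquiv.refl ℝ (Fin d → Fin d → ℝ) :
      Matrix (Fin d) (Fin d) ℝ ≃ₗ[ℝ] (Fin d → Fin d → ℝ)).toContinuousLinearEquiv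
  have h1 : HasDerivWithinAt P P' s t ↔ HasDerivWithinAt (fun s => e (P s)) (e P') s t :=
    ⟨fun h => e.toContinuousLinearMap.hasFDerivAt.comp_hasDerivWithinAt t h,
      fun h => e.symm.toContinuousLinearMap.hasFDerivAt.comp_hasDerivWithinAt t h⟩
  rw [h1, hasDerivWithinAt_pi]
  exact forall_congr' fun i => hasDerivWithinAt_pi

theorem hasDerivAt_matrix_iff {P : ℝ → Matrix (Fin d) (Fin d) ℝ} {P' : Matrix (Fin d) (Fin d) ℝ}
    {t : ℝ} :
    HasDerivAt P P' t ↔ ∀ i j, HasDerivAt (fun s => P s i j) (P' i j) t := by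
  have h := hasDerivWithinAt_matrix_iff (P := P) (P' := P') (s := univ) (t := t)
  simp only [hasDerivWithinAt_univ (F := ℝ)] at h
  exact hasDerivWithinAt_univ.symm.trans h

theorem HasDerivAt.matrix_transpose {P : ℝ → Matrix (Fin d) (Fin d) ℝ}
    {P' : Matrix (Fin d) (Fin d) ℝ} {t : ℝ} (h : HasDerivAt P P' t) :
    HasDerivAt (fun s => (P s)ᵀ) P'ᵀ t :=
  hasDerivAt_matrix_iff.2 fun i j => hasDerivAt_matrix_iff.1 h j i

theorem HasDerivAt.matrix_mulVec {P : ℝ → Matrix (Fin d) (Fin d) ℝ}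
    {P' : Matrix (Fin d) (Fin d) ℝ} {x : ℝ → Fin d → ℝ} {x' : Fin d → ℝ} {t : ℝ}
    (h : HasDerivAt P P' t) (hx : HasDerivAt x x' t) :
    HasDerivAt (fun s => P s *ᵥ x s) (P' *ᵥ x t + P t *ᵥ x') t := by
  refine hasDerivAt_pi.2 fun i => ?_
  have := HasDerivAt.fun_sum (u := Finset.univ) fun j (_ : j ∈ Finset.univ) =>
    (hasDerivAt_matrix_iff.1 h i j).mul (hasDerivAt_pi.1 hx j)
  refine this.congr_deriv ?_
  simp [Matrix.mulVec, dotProduct, Finset.sum_add_distrib]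

theorem HasDerivAt.const_mulVec (P : Matrix (Fin d) (Fin d) ℝ) {x : ℝ → Fin d → ℝ}
    {x' : Fin d → ℝ} {t : ℝ} (hx : HasDerivAt x x' t) :
    HasDerivAt (fun s => P *ᵥ x s) (P *ᵥ x') t := by
  simpa using (hasDerivAt_const t P).matrix_mulVec hx

theorem HasDerivAt.dotProduct {x y : ℝ → Fin d → ℝ} {x' y' : Fin d → ℝ} {t : ℝ}
    (hx : HasDerivAt x x' t) (hy : HasDerivAt y y' t) :
    HasDerivAt (fun s => x s ⬝ᵥ y s) (x' ⬝ᵥ y t + x t ⬝ᵥ y') t := by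
  have := HasDerivAt.fun_sum (u := Finset.univ) fun j (_ : j ∈ Finset.univ) =>
    (hasDerivAt_pi.1 hx j).mul (hasDerivAt_pi.1 hy j)
  refine this.congr_deriv ?_
  simp [_root_.dotProduct, Finset.sum_add_distrib]

theorem HasDerivAt.matrix_inv {P : ℝ → Matrix (Fin d) (Fin d) ℝ}
    {P' : Matrix (Fin d) (Fin d) ℝ} {t : ℝ} (h : HasDerivAt P P' t) (hP : IsUnit (P t)) :
    HasDerivAt (fun s => (P s)⁻¹) (-((P t)⁻¹ * P' * (P t)⁻¹)) t := by
  obtain ⟨u, hu⟩ := hP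
  have h1 := hasFDerivAt_ringInverse (𝕜 := ℝ) u
  rw [hu] at h1
  have h2 := h1.comp_hasDerivAt t h
  simp only [Matrix.nonsing_inv_eq_ringInverse]
  refine h2.congr_deriv ?_
  simp [← hu]

theorem exists_linear_flow {E : Type*} [NormedAddCommGroup E] [NormedSpace ℝ E]
    [FiniteDimensional ℝ E] (L : E →ₗ[ℝ] E) (x₀ : E) :
    ∃ x : ℝ → E, x 0 = x₀ ∧ ∀ t, HasDerivAt x (L (x t)) t := by
  have : CompleteSpace E := FiniteDimensional.complete ℝ E
  let l : E →L[ℝ] E := L.toContinuousLinearMap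
  refine ⟨fun t => NormedSpace.exp (t • l) x₀, by simp, fun t => ?_⟩
  have h := hasDerivAt_exp_smul_const' l t
  exact (ContinuousLinearMap.apply ℝ E x₀).hasFDerivAt.comp_hasDerivAt t h

/-- The linear Hamiltonian system which linearises the matrix Riccati equation. -/
theorem exists_hamiltonian_flow (A R q : Matrix (Fin d) (Fin d) ℝ) :
    ∃ U V : ℝ → Matrix (Fin d) (Fin d) ℝ, U 0 = 1 ∧ V 0 = 0 ∧
      (∀ t, HasDerivAt U (A * U t + R * V t) t) ∧
      ∀ t, HasDerivAt V (q * U t - Aᵀ * V t) t := by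
  let E := Matrix (Fin d) (Fin d) ℝ
  let L : (E × E) →ₗ[ℝ] (E × E) :=
    { toFun := fun p => (A * p.1 + R * p.2, q * p.1 - Aᵀ * p.2)
      map_add' := fun x y => by ext1 <;> simp <;> noncomm_ring
      map_smul' := fun c x => by ext1 <;> simp [smul_sub] }
  obtain ⟨x, hx0, hx⟩ := exists_linear_flow L (1, 0)
  refine ⟨fun t => (x t).1, fun t => (x t).2, by simp [hx0], by simp [hx0], fun t => ?_, fun t => ?_⟩
  · exact (ContinuousLinearMap.fst ℝ E E).hasFDerivAt.comp_hasDerivAt t (hx t)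
  · exact (ContinuousLinearMap.snd ℝ E E).hasFDerivAt.comp_hasDerivAt t (hx t)

/-- The flow preserves the symplectic form, so `Uᵀ V - Vᵀ U` keeps its initial value 0. This is what
makes `V U⁻¹` symmetric. -/
theorem hamiltonian_flow_symm {A R q : Matrix (Fin d) (Fin d) ℝ} (hR : Rᵀ = R) (hq : qᵀ = q)
    {U V : ℝ → Matrix (Fin d) (Fin d) ℝ} (hV0 : V 0 = 0)
    (hU : ∀ t, HasDerivAt U (A * U t + R * V t) t)
    (hV : ∀ t, HasDerivAt V (q * U t - Aᵀ * V t) t) (t : ℝ) :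
    (U t)ᵀ * V t = (V t)ᵀ * U t := by
  have h : ∀ s, HasDerivAt (fun s => (U s)ᵀ * V s - (V s)ᵀ * U s) 0 s := fun s => by
    refine (((hU s).matrix_transpose.mul (hV s)).sub
      ((hV s).matrix_transpose.mul (hU s))).congr_deriv ?_
    simp only [Matrix.transpose_add, Matrix.transpose_sub, Matrix.transpose_mul, hR, hq,
      Matrix.transpose_transpose]
    noncomm_ring
  have := is_const_of_deriv_eq_zero (fun s => (h s).differentiableAt) (fun s => (h s).deriv) t 0
  simpa [hV0, sub_eq_zero] using this

/-- The symplectic pairing `Uᵀ V' - Vᵀ U'` of the flow with its velocity is constant, since the flow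
commutes with its generator. For `X = V U⁻¹` it equals `Uᵀ X' U`, which gives the sign of `X'`. -/
theorem hamiltonian_flow_conserved {A R q : Matrix (Fin d) (Fin d) ℝ} (hR : Rᵀ = R) (hq : qᵀ = q)
    {U V : ℝ → Matrix (Fin d) (Fin d) ℝ} (hU0 : U 0 = 1) (hV0 : V 0 = 0)
    (hU : ∀ t, HasDerivAt U (A * U t + R * V t) t)
    (hV : ∀ t, HasDerivAt V (q * U t - Aᵀ * V t) t) (t : ℝ) :
    (U t)ᵀ * (q * U t - Aᵀ * V t) - (V t)ᵀ * (A * U t + R * V t) = q := by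
  have h : ∀ s, HasDerivAt (fun s => (U s)ᵀ * (q * U s - Aᵀ * V s)
      - (V s)ᵀ * (A * U s + R * V s)) 0 s := fun s => by
    refine (((hU s).matrix_transpose.mul (((hU s).const_mul q).sub ((hV s).const_mul Aᵀ))).sub
      ((hV s).matrix_transpose.mul
        (((hU s).const_mul A).add ((hV s).const_mul R)))).congr_deriv ?_
    simp only [Matrix.transpose_add, Matrix.transpose_sub, Matrix.transpose_mul, hR, hq,
      Matrix.transpose_transpose, Pi.sub_apply, Pi.add_apply]
    noncomm_ring
  have := is_const_of_deriv_eq_zero (fun s => (h s).differentiableAt) (fun s => (h s).deriv) t 0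
  simpa [hU0, hV0] using this

theorem quadForm_nonneg {P : Matrix (Fin d) (Fin d) ℝ} (hP : P.PosSemidef) (v : Fin d → ℝ) :
    0 ≤ v ⬝ᵥ P *ᵥ v := by
  simpa using hP.dotProduct_mulVec_nonneg v

theorem quadForm_pos {P : Matrix (Fin d) (Fin d) ℝ} (hP : P.PosDef) {v : Fin d → ℝ}
    (hv : v ≠ 0) : 0 < v ⬝ᵥ P *ᵥ v := by
  simpa using hP.dotProduct_mulVec_pos hv

theorem transpose_eq_of_posSemidef {P : Matrix (Fin d) (Fin d) ℝ} (hP : P.PosSemidef) :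
    Pᵀ = P := by
  simpa [Matrix.IsHermitian] using hP.isHermitian

/-- `vᵀ (Pᵀ Q) w = (P v)ᵀ (Q w)`. -/
theorem dotProduct_transpose_mul_mulVec (P Q : Matrix (Fin d) (Fin d) ℝ) (v w : Fin d → ℝ) :
    v ⬝ᵥ (Pᵀ * Q) *ᵥ w = (P *ᵥ v) ⬝ᵥ (Q *ᵥ w) := by
  rw [← Matrix.mulVec_mulVec, Matrix.dotProduct_mulVec, Matrix.vecMul_transpose]

theorem hamiltonian_flow_hasDerivAt_quadForm {A R q : Matrix (Fin d) (Fin d) ℝ} (hR : Rᵀ = R)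
    {U V : ℝ → Matrix (Fin d) (Fin d) ℝ}
    (hU : ∀ t, HasDerivAt U (A * U t + R * V t) t)
    (hV : ∀ t, HasDerivAt V (q * U t - Aᵀ * V t) t) (v : Fin d → ℝ) (t : ℝ) :
    HasDerivAt (fun t => (U t *ᵥ v) ⬝ᵥ (V t *ᵥ v))
      ((V t *ᵥ v) ⬝ᵥ R *ᵥ (V t *ᵥ v) + (U t *ᵥ v) ⬝ᵥ q *ᵥ (U t *ᵥ v)) t := by
  have h := ((hU t).matrix_mulVec (hasDerivAt_const t v)).dotProduct
    ((hV t).matrix_mulVec (hasDerivAt_const t v))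
  refine h.congr_deriv ?_
  simp only [Matrix.mulVec_zero, add_zero, Matrix.add_mulVec, Matrix.sub_mulVec,
    ← Matrix.mulVec_mulVec, add_dotProduct, dotProduct_sub]
  rw [Matrix.dotProduct_mulVec (U t *ᵥ v) Aᵀ, Matrix.vecMul_transpose,
    Matrix.dotProduct_mulVec (V t *ᵥ v) R, ← Matrix.mulVec_transpose, hR]
  ring

theorem hamiltonian_flow_quadForm_monotone {A R q : Matrix (Fin d) (Fin d) ℝ}
    (hR : R.PosSemidef) (hq : q.PosDef) {U V : ℝ → Matrix (Fin d) (Fin d) ℝ}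
    (hU : ∀ t, HasDerivAt U (A * U t + R * V t) t)
    (hV : ∀ t, HasDerivAt V (q * U t - Aᵀ * V t) t) (v : Fin d → ℝ) :
    Monotone fun t => (U t *ᵥ v) ⬝ᵥ (V t *ᵥ v) := by
  have h := hamiltonian_flow_hasDerivAt_quadForm (transpose_eq_of_posSemidef hR) hU hV v
  refine monotone_of_deriv_nonneg (fun t => (h t).differentiableAt) fun t => ?_
  rw [(h t).deriv]
  exact add_nonneg (quadForm_nonneg hR _) (quadForm_nonneg hq.posSemidef _)

/-- If `U t v = 0`, the monotone function `(U v) ⬝ᵥ (V v)` vanishes at 0 and at `t`, hence in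
between. Its derivative at 0 is `v ⬝ᵥ q v`, which forces `v = 0`. -/
theorem hamiltonian_flow_isUnit {A R q : Matrix (Fin d) (Fin d) ℝ} (hR : R.PosSemidef)
    (hq : q.PosDef) {U V : ℝ → Matrix (Fin d) (Fin d) ℝ} (hU0 : U 0 = 1) (hV0 : V 0 = 0)
    (hU : ∀ t, HasDerivAt U (A * U t + R * V t) t)
    (hV : ∀ t, HasDerivAt V (q * U t - Aᵀ * V t) t) {t : ℝ} (ht : 0 ≤ t) : IsUnit (U t) := by
  rw [Matrix.isUnit_iff_isUnit_det, isUnit_iff_ne_zero]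
  intro hdet
  obtain ⟨v, hv, hUv⟩ := Matrix.exists_mulVec_eq_zero_iff.2 hdet
  have hm := hamiltonian_flow_quadForm_monotone hR hq hU hV v
  rcases ht.eq_or_lt with rfl | ht
  · simp [hU0] at hUv
    exact hv hUv
  have hz : ∀ s ∈ Icc 0 t, (U s *ᵥ v) ⬝ᵥ (V s *ᵥ v) = 0 := fun s hs => by
    have h1 := hm hs.1
    have h2 := hm hs.2
    simp only [hUv, hV0, zero_dotProduct, Matrix.zero_mulVec, dotProduct_zero] at h1 h2
    exact le_antisymm h2 h1
  have h := hamiltonian_flow_hasDerivAt_quadForm (transpose_eq_of_posSemidef hR) hU hV v 0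
  have h1 : HasDerivWithinAt (fun s => (U s *ᵥ v) ⬝ᵥ (V s *ᵥ v)) 0 (Icc 0 t) 0 :=
    (hasDerivWithinAt_const (0 : ℝ) (Icc 0 t) (0 : ℝ)).congr hz (hz 0 ⟨le_rfl, ht.le⟩)
  have h2 := (uniqueDiffOn_Icc ht 0 ⟨le_rfl, ht.le⟩).eq_deriv _ h1 h.hasDerivWithinAt
  simp only [hV0, hU0, Matrix.zero_mulVec, zero_dotProduct, Matrix.one_mulVec, zero_add] at h2
  exact (quadForm_pos hq hv).ne h2

end MatrixCalculus

/-! ### Asymptotics of scalar functions -/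

section Scalar

/-- Once `h < c ε / 2`, the function `(w - ε / 2) exp (c t)` decreases, so `w` exceeds `ε / 2` by at
most an exponentially small amount. -/
theorem tendsto_zero_of_deriv_le {w w' h : ℝ → ℝ} {c : ℝ} (hc : 0 < c) (hw0 : ∀ t, 0 ≤ w t)
    (hw : ∀ t, 0 ≤ t → HasDerivAt w (w' t) t)
    (hle : ∀ᶠ t in atTop, w' t ≤ -c * w t + h t) (hh : Tendsto h atTop (𝓝 0)) :
    Tendsto w atTop (𝓝 0) := by
  rw [Metric.tendsto_atTop]
  intro ε hε
  have hce : 0 < c * (ε / 2) := by positivity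
  obtain ⟨t₁, ht₁⟩ := eventually_atTop.1
    ((hle.and (hh.eventually_lt_const hce)).and (eventually_ge_atTop 0))
  have hd : ∀ t, t₁ ≤ t → HasDerivAt (fun t => (w t - ε / 2) * Real.exp (c * t))
      (w' t * Real.exp (c * t) + (w t - ε / 2) * (Real.exp (c * t) * c)) t := fun t ht =>
    ((hw t (ht₁ t ht).2).sub_const _).mul
      (((hasDerivAt_id t).const_mul c).exp.congr_deriv (by simp))
  have hanti : AntitoneOn (fun t => (w t - ε / 2) * Real.exp (c * t)) (Ici t₁) := by
    refine antitoneOn_of_deriv_nonpos (convex_Ici t₁)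
      (fun t ht => (hd t ht).continuousAt.continuousWithinAt)
      (fun t ht => (hd t (interior_subset ht)).differentiableAt.differentiableWithinAt)
      fun t ht => ?_
    have ht' : t₁ ≤ t := interior_subset ht
    rw [(hd t ht').deriv]
    have h1 := (ht₁ t ht').1
    have : w' t * Real.exp (c * t) + (w t - ε / 2) * (Real.exp (c * t) * c)
        = (w' t + c * w t - c * (ε / 2)) * Real.exp (c * t) := by ring
    rw [this]
    exact mul_nonpos_of_nonpos_of_nonneg (by linarith) (Real.exp_pos _).le
  have hexp : Tendsto (fun t => ((w t₁ - ε / 2) * Real.exp (c * t₁)) * Real.exp (-(c * t)))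
      atTop (𝓝 0) := by
    rw [show (0 : ℝ) = ((w t₁ - ε / 2) * Real.exp (c * t₁)) * 0 by simp]
    exact (Real.tendsto_exp_neg_atTop_nhds_zero.comp
      (tendsto_id.const_mul_atTop hc)).const_mul _
  obtain ⟨t₂, ht₂⟩ := eventually_atTop.1 (hexp.eventually_lt_const (half_pos hε))
  refine ⟨max t₁ t₂, fun t ht => ?_⟩
  have h1 := hanti self_mem_Ici (mem_Ici.2 ((le_max_left _ _).trans ht))
    ((le_max_left _ _).trans ht)
  have h2 := ht₂ t ((le_max_right _ _).trans ht)
  have h3 : w t - ε / 2 ≤ ((w t₁ - ε / 2) * Real.exp (c * t₁)) * Real.exp (-(c * t)) := by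
    rw [Real.exp_neg, ← div_eq_mul_inv, le_div_iff₀ (Real.exp_pos _)]
    exact h1
  rw [Real.dist_eq, sub_zero, abs_of_nonneg (hw0 t)]
  linarith

/-- The mean value theorem on `[n, n + 1]` gives points tending to infinity where `f'` equals an
increment of `f`, and these increments tend to 0. -/
theorem deriv_limit_eq_zero {f f' : ℝ → ℝ} {l l' : ℝ} (hf : ∀ t, 0 ≤ t → HasDerivAt f (f' t) t)
    (hl : Tendsto f atTop (𝓝 l)) (hl' : Tendsto f' atTop (𝓝 l')) : l' = 0 := by
  have hex : ∀ n : ℕ, ∃ ξ ∈ Ioo (n : ℝ) (n + 1), f' ξ = f (n + 1) - f n := fun n => by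
    obtain ⟨ξ, hξ, h⟩ := exists_hasDerivAt_eq_slope f f' (lt_add_one (n : ℝ))
      (fun t ht => (hf t (n.cast_nonneg.trans ht.1)).continuousAt.continuousWithinAt)
      (fun t ht => hf t (n.cast_nonneg.trans ht.1.le))
    exact ⟨ξ, hξ, by simpa using h⟩
  choose ξ hξ h using hex
  have h1 : Tendsto ξ atTop atTop :=
    tendsto_atTop_mono (fun n => (hξ n).1.le) tendsto_natCast_atTop_atTop
  have h2 : Tendsto (fun n : ℕ => f (n + 1) - f n) atTop (𝓝 (l - l)) :=
    (hl.comp (tendsto_atTop_add_const_right _ 1 tendsto_natCast_atTop_atTop)).sub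
      (hl.comp tendsto_natCast_atTop_atTop)
  simpa using tendsto_nhds_unique ((hl'.comp h1).congr h) h2

/-- A function whose derivative converges grows linearly, with the limit as its rate. -/
theorem tendsto_div_of_tendsto_deriv {f f' : ℝ → ℝ} {l : ℝ}
    (hf : ∀ t, 0 ≤ t → HasDerivAt f (f' t) t) (hl : Tendsto f' atTop (𝓝 l)) :
    Tendsto (fun t => f t / t) atTop (𝓝 l) := by
  rw [Metric.tendsto_atTop]
  intro ε hε
  obtain ⟨t₁, ht₁⟩ := eventually_atTop.1
    ((Metric.tendsto_nhds.1 hl (ε / 2) (half_pos hε)).and (eventually_gt_atTop 0))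
  have hbd : ∀ t, t₁ ≤ t → |(f t - l * t) - (f t₁ - l * t₁)| ≤ ε / 2 * (t - t₁) := fun t ht => by
    have := (convex_Icc t₁ t).norm_image_sub_le_of_norm_hasDerivWithin_le
      (f := fun s => f s - l * s) (f' := fun s => f' s - l) (C := ε / 2)
      (fun s hs => (((hf s (ht₁ s hs.1).2.le).sub
        (((hasDerivAt_id s).const_mul l).congr_deriv (mul_one l))).hasDerivWithinAt))
      (fun s hs => by simpa [Real.dist_eq] using (ht₁ s hs.1).1.le)
      (left_mem_Icc.2 ht) (right_mem_Icc.2 ht)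
    simpa [Real.norm_eq_abs, abs_of_nonneg (sub_nonneg.2 ht)] using this
  have hlim : Tendsto (fun t : ℝ => (|f t₁ - l * t₁|) / t) atTop (𝓝 0) :=
    tendsto_const_nhds.div_atTop tendsto_id
  obtain ⟨t₂, ht₂⟩ := eventually_atTop.1 (hlim.eventually_lt_const (half_pos hε))
  refine ⟨max t₁ t₂, fun t ht => ?_⟩
  have htt : t₁ ≤ t := (le_max_left _ _).trans ht
  have hpos : 0 < t := (ht₁ t htt).2
  have hpos1 : 0 < t₁ := (ht₁ t₁ le_rfl).2
  have h1 := hbd t htt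
  have h2 := ht₂ t ((le_max_right _ _).trans ht)
  rw [div_lt_iff₀ hpos] at h2
  have h3 : f t / t - l = (f t - l * t) / t := by field_simp
  rw [Real.dist_eq, h3, abs_div, abs_of_pos hpos, div_lt_iff₀ hpos]
  have h4 : |f t - l * t| ≤ |(f t - l * t) - (f t₁ - l * t₁)| + |f t₁ - l * t₁| := by
    simpa using abs_add_le ((f t - l * t) - (f t₁ - l * t₁)) (f t₁ - l * t₁)
  nlinarith

theorem exists_primitive_of_continuousOn_Ici {E : Type*} [NormedAddCommGroup E] [NormedSpace ℝ E]
    [CompleteSpace E] {g : ℝ → E} (hg : ContinuousOn g (Ici 0)) :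
    ∃ G : ℝ → E, G 0 = 0 ∧ ∀ t, 0 ≤ t → HasDerivAt G (g t) t := by
  -- Freezing `g` at `g 0` for negative times makes the derivative of the primitive at 0 two-sided.
  have hc : Continuous fun s : ℝ => g (max s 0) :=
    hg.comp_continuous (continuous_id.max continuous_const) fun s => mem_Ici.2 (le_max_right _ _)
  refine ⟨fun t => ∫ s in (0 : ℝ)..t, g (max s 0), by simp, fun t ht => ?_⟩
  have := (hc.integral_hasStrictDerivAt 0 t).hasDerivAt
  rwa [max_eq_left ht] at this

end Scalar

/-! ### Quadratic forms, Lyapunov stability and monotone convergence of matrices -/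

section QuadForm

variable {d : ℕ}

theorem mul_self_le_dotProduct_self (v : Fin d → ℝ) (i : Fin d) : v i * v i ≤ v ⬝ᵥ v :=
  Finset.single_le_sum (f := fun i => v i * v i) (fun i _ => mul_self_nonneg (v i))
    (Finset.mem_univ i)

theorem dotProduct_self_nonneg' (v : Fin d → ℝ) : 0 ≤ v ⬝ᵥ v :=
  Finset.sum_nonneg fun i _ => mul_self_nonneg (v i)

theorem abs_quadForm_le (P : Matrix (Fin d) (Fin d) ℝ) (v : Fin d → ℝ) :
    |v ⬝ᵥ P *ᵥ v| ≤ (∑ i, ∑ j, |P i j|) * (v ⬝ᵥ v) := by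
  have h : v ⬝ᵥ P *ᵥ v = ∑ i, ∑ j, v i * (P i j * v j) := by
    simp [dotProduct, Matrix.mulVec, Finset.mul_sum]
  rw [h, Finset.sum_mul]
  refine (Finset.abs_sum_le_sum_abs _ _).trans (Finset.sum_le_sum fun i _ => ?_)
  rw [Finset.sum_mul]
  refine (Finset.abs_sum_le_sum_abs _ _).trans (Finset.sum_le_sum fun j _ => ?_)
  have h1 : |v i * (P i j * v j)| = |P i j| * |v i * v j| := by
    rw [← abs_mul]; ring_nf
  rw [h1]
  refine mul_le_mul_of_nonneg_left ?_ (abs_nonneg _)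
  have hi := mul_self_le_dotProduct_self v i
  have hj := mul_self_le_dotProduct_self v j
  rw [abs_le]
  constructor <;> nlinarith [mul_self_nonneg (v i - v j), mul_self_nonneg (v i + v j)]

theorem dotProduct_mulVec_comm_of_transpose_eq {P : Matrix (Fin d) (Fin d) ℝ} (hP : Pᵀ = P)
    (v w : Fin d → ℝ) : v ⬝ᵥ P *ᵥ w = w ⬝ᵥ P *ᵥ v := by
  rw [Matrix.dotProduct_mulVec, ← Matrix.mulVec_transpose, hP, dotProduct_comm]

theorem exists_quadForm_ge {P : Matrix (Fin d) (Fin d) ℝ} (hP : P.PosDef) :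
    ∃ c > 0, ∀ v : Fin d → ℝ, c * (v ⬝ᵥ v) ≤ v ⬝ᵥ P *ᵥ v := by
  -- `C` bounds the quadratic form of `P⁻¹`; the `+ 1` keeps it positive even for `d = 0`.
  set C : ℝ := (∑ i, ∑ j, |P⁻¹ i j|) + 1
  have hC : 0 < C := by positivity
  have hdet : IsUnit P.det := hP.det_pos.ne'.isUnit
  refine ⟨C⁻¹, by positivity, fun v => ?_⟩
  -- Testing `P` on this vector gives `0 ≤ vᵀ P v - 2 C⁻¹ |v|² + C⁻² vᵀ P⁻¹ v`, and the last term is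
  -- at most `C⁻¹ |v|²`.
  have h1 := quadForm_nonneg hP.posSemidef (v - C⁻¹ • (P⁻¹ *ᵥ v))
  have h2 : v ⬝ᵥ P⁻¹ *ᵥ v ≤ C * (v ⬝ᵥ v) := by
    have := (le_abs_self _).trans (abs_quadForm_le P⁻¹ v)
    have h3 := dotProduct_self_nonneg' v
    simp only [C, add_mul, one_mul]
    linarith
  have h4 : P *ᵥ (P⁻¹ *ᵥ v) = v := by
    rw [Matrix.mulVec_mulVec, Matrix.mul_nonsing_inv _ hdet, Matrix.one_mulVec]
  have h5 : (P⁻¹ *ᵥ v) ⬝ᵥ P *ᵥ v = v ⬝ᵥ v := by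
    rw [dotProduct_mulVec_comm_of_transpose_eq (transpose_eq_of_posSemidef hP.posSemidef), h4]
  simp only [Matrix.mulVec_sub, Matrix.mulVec_smul, h4, sub_dotProduct, dotProduct_sub,
    smul_dotProduct, dotProduct_smul, smul_eq_mul, h5, dotProduct_comm (P⁻¹ *ᵥ v) v] at h1
  have h6 : C⁻¹ * (C⁻¹ * (v ⬝ᵥ P⁻¹ *ᵥ v)) ≤ C⁻¹ * (v ⬝ᵥ v) := by
    rw [inv_mul_le_iff₀ hC, inv_mul_le_iff₀ hC]
    calc _ ≤ C * (v ⬝ᵥ v) := h2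
      _ = _ := by field_simp
  linarith

theorem abs_two_mul_dotProduct_le {c : ℝ} (hc : 0 < c) (v w : Fin d → ℝ) :
    |2 * (v ⬝ᵥ w)| ≤ c * (v ⬝ᵥ v) + c⁻¹ * (w ⬝ᵥ w) := by
  have h1 := dotProduct_self_nonneg' (c • v - w)
  have h2 := dotProduct_self_nonneg' (c • v + w)
  simp only [sub_dotProduct, add_dotProduct, dotProduct_sub, dotProduct_add, smul_dotProduct,
    dotProduct_smul, smul_eq_mul, dotProduct_comm w v] at h1 h2
  have h3 : c * (v ⬝ᵥ v) + c⁻¹ * (w ⬝ᵥ w) = c⁻¹ * (c * (c * (v ⬝ᵥ v)) + w ⬝ᵥ w) := by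
    field_simp
  rw [h3, le_inv_mul_iff₀ hc, ← abs_of_pos hc, ← abs_mul, abs_of_pos hc, abs_le]
  constructor <;> linarith

/-- The solution of an asymptotically autonomous linear equation `b' = -M(t)ᵀ b - g(t)` converges,
if the limit `S` of `M` has a quadratic Lyapunov function. -/
theorem tendsto_of_lyapunov {P S : Matrix (Fin d) (Fin d) ℝ} (hP : P.PosDef)
    (hS : (P * S + Sᵀ * P).PosDef) {M : ℝ → Matrix (Fin d) (Fin d) ℝ} {b g : ℝ → Fin d → ℝ}
    {g₀ : Fin d → ℝ} (hM : Tendsto M atTop (𝓝 S)) (hg : Tendsto g atTop (𝓝 g₀))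
    (hb : ∀ t, 0 ≤ t → HasDerivAt b (-((M t)ᵀ *ᵥ b t) - g t) t) :
    ∃ b₀, Tendsto b atTop (𝓝 b₀) := by
  have hPt := transpose_eq_of_posSemidef hP.posSemidef
  have hPdet : IsUnit P.det := hP.det_pos.ne'.isUnit
  have hSdet : IsUnit Sᵀ.det := by
    rw [Matrix.det_transpose, isUnit_iff_ne_zero]
    intro h0
    obtain ⟨v, hv, hSv⟩ := Matrix.exists_mulVec_eq_zero_iff.2 h0
    have := quadForm_pos hS hv
    rw [Matrix.add_mulVec, dotProduct_add, dotProduct_transpose_mul_mulVec,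
      ← Matrix.mulVec_mulVec, hSv] at this
    simp at this
  -- The equilibrium of the limiting equation `b' = -Sᵀ b - g₀`.
  set b₀ : Fin d → ℝ := -((Sᵀ)⁻¹ *ᵥ g₀) with hb₀
  have hSb : Sᵀ *ᵥ b₀ = -g₀ := by
    rw [hb₀, Matrix.mulVec_neg, Matrix.mulVec_mulVec, Matrix.mul_nonsing_inv _ hSdet,
      Matrix.one_mulVec]
  -- The equation contains the transpose of `M`, so the Lyapunov function is the form of `P⁻¹` at `b
  -- - b₀`. In the variable `y` it is the form of `P`, and `P S + Sᵀ P` governs its decay.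
  set y : ℝ → Fin d → ℝ := fun t => P⁻¹ *ᵥ (b t - b₀) with hy
  have hPy : ∀ t, P *ᵥ y t = b t - b₀ := fun t => by
    rw [hy, Matrix.mulVec_mulVec, Matrix.mul_nonsing_inv _ hPdet, Matrix.one_mulVec]
  set h : ℝ → Fin d → ℝ := fun t => (M t)ᵀ *ᵥ b₀ + g t with hh
  have hh0 : Tendsto h atTop (𝓝 0) := by
    have h1 : Tendsto (fun t => (M t)ᵀ *ᵥ b₀) atTop (𝓝 (Sᵀ *ᵥ b₀)) :=
      ((Continuous.matrix_mulVec (Continuous.matrix_transpose continuous_id)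
        continuous_const).tendsto S).comp hM
    simpa [hSb] using h1.add hg
  set W : ℝ → ℝ := fun t => y t ⬝ᵥ P *ᵥ y t with hW
  have hWd : ∀ t, 0 ≤ t → HasDerivAt W
      (-(y t ⬝ᵥ (P * M t + (M t)ᵀ * P) *ᵥ y t) - 2 * (y t ⬝ᵥ h t)) t := fun t ht => by
    have h1 : HasDerivAt (fun t => b t - b₀) (-((M t)ᵀ *ᵥ (b t - b₀)) - h t) t := by
      refine ((hb t ht).sub_const b₀).congr_deriv ?_
      simp only [hh, Matrix.mulVec_sub]
      abel
    have h2 : HasDerivAt y (P⁻¹ *ᵥ (-((M t)ᵀ *ᵥ (b t - b₀)) - h t)) t :=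
      h1.const_mulVec P⁻¹
    have h3 := h2.dotProduct h1
    simp only [← hPy] at h3
    refine h3.congr_deriv ?_
    have h4 : ∀ x, (P⁻¹ *ᵥ x) ⬝ᵥ P *ᵥ y t = y t ⬝ᵥ x := fun x => by
      rw [dotProduct_mulVec_comm_of_transpose_eq hPt, Matrix.mulVec_mulVec,
        Matrix.mul_nonsing_inv _ hPdet, Matrix.one_mulVec]
    rw [h4, Matrix.add_mulVec, dotProduct_add, dotProduct_sub, dotProduct_neg,
      Matrix.mulVec_mulVec]
    have h5 : y t ⬝ᵥ (P * M t) *ᵥ y t = y t ⬝ᵥ ((M t)ᵀ * P) *ᵥ y t := by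
      rw [dotProduct_transpose_mul_mulVec, ← Matrix.mulVec_mulVec,
        dotProduct_mulVec_comm_of_transpose_eq hPt]
    rw [h5]
    ring
  obtain ⟨c, hc, hcS⟩ := exists_quadForm_ge hS
  obtain ⟨c₁, hc₁, hcP⟩ := exists_quadForm_ge hP
  set C : ℝ := (∑ i, ∑ j, |P i j|) + 1
  have hC : 0 < C := by positivity
  have hWC : ∀ t, W t ≤ C * (y t ⬝ᵥ y t) := fun t => by
    have := (le_abs_self _).trans (abs_quadForm_le P (y t))
    have h3 := dotProduct_self_nonneg' (y t)
    simp only [C, add_mul, one_mul, hW]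
    linarith
  have hQ : Tendsto (fun t => ∑ i, ∑ j, |((P * M t + (M t)ᵀ * P) - (P * S + Sᵀ * P)) i j|)
      atTop (𝓝 0) := by
    have hcont : Continuous fun N : Matrix (Fin d) (Fin d) ℝ =>
        ∑ i, ∑ j, |((P * N + Nᵀ * P) - (P * S + Sᵀ * P)) i j| := by
      refine continuous_finsetSum _ fun i _ => continuous_finsetSum _ fun j _ =>
        (Continuous.matrix_elem ?_ i j).abs
      fun_prop
    have := (hcont.tendsto S).comp hM
    simpa [Function.comp_def] using this
  have hW0 : Tendsto W atTop (𝓝 0) := by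
    -- Of the decay `c |y|²`, one quarter absorbs the error `M - S` and one quarter the cross term
    -- with `h`. The remaining half dominates `c / (2 C) * W`.
    refine tendsto_zero_of_deriv_le (c := c / (2 * C)) (h := fun t => (c / 4)⁻¹ * (h t ⬝ᵥ h t))
      (by positivity) (fun t => quadForm_nonneg hP.posSemidef _) hWd ?_ ?_
    · filter_upwards [hQ.eventually_lt_const (show (0 : ℝ) < c / 4 by positivity)] with t ht
      have h1 := hcS (y t)
      have h2 := abs_quadForm_le ((P * M t + (M t)ᵀ * P) - (P * S + Sᵀ * P)) (y t)
      have h3 := mul_le_mul_of_nonneg_right ht.le (dotProduct_self_nonneg' (y t))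
      have h4 := (abs_le.1 (h2.trans h3)).1
      rw [Matrix.sub_mulVec, dotProduct_sub] at h4
      have h5 := (abs_le.1 (abs_two_mul_dotProduct_le (show (0 : ℝ) < c / 4 by positivity)
        (y t) (h t))).1
      have h6 : c / (2 * C) * W t ≤ c / 2 * (y t ⬝ᵥ y t) := by
        calc c / (2 * C) * W t ≤ c / (2 * C) * (C * (y t ⬝ᵥ y t)) := by
              gcongr
              exact hWC t
          _ = _ := by field_simp
      linarith
    · have hcont : Continuous fun v : Fin d → ℝ => (c / 4)⁻¹ * (v ⬝ᵥ v) := by fun_prop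
      simpa [Function.comp_def] using (hcont.tendsto 0).comp hh0
  have hyy : Tendsto (fun t => y t ⬝ᵥ y t) atTop (𝓝 0) := by
    refine squeeze_zero (fun t => dotProduct_self_nonneg' _) (fun t => ?_)
      (by simpa using hW0.const_mul c₁⁻¹)
    rw [le_inv_mul_iff₀ hc₁]
    exact hcP (y t)
  have hy0 : Tendsto y atTop (𝓝 0) := by
    rw [tendsto_pi_nhds]
    intro i
    have : Tendsto (fun t => y t i * y t i) atTop (𝓝 0) :=
      squeeze_zero (fun t => mul_self_nonneg _) (fun t => mul_self_le_dotProduct_self _ i) hyy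
    have h2 := (Real.continuous_sqrt.tendsto 0).comp this
    simp only [Real.sqrt_zero] at h2
    exact (tendsto_zero_iff_abs_tendsto_zero _).2
      (h2.congr fun t => Real.sqrt_mul_self_eq_abs (y t i))
  refine ⟨b₀, ?_⟩
  have hcont : Continuous fun v : Fin d → ℝ => P *ᵥ v + b₀ := by fun_prop
  have := (hcont.tendsto 0).comp hy0
  simp only [Matrix.mulVec_zero, zero_add] at this
  exact this.congr fun t => by simp [hPy]

/-- Bounded monotone forms converge, and polarisation recovers the entries. Bounds on the diagonal
suffice: testing a positive semidefinite matrix on `eᵢ - eⱼ` gives `2 Xᵢⱼ ≤ Xᵢᵢ + Xⱼⱼ`. -/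
theorem exists_tendsto_of_monotone_quadForm {X : ℝ → Matrix (Fin d) (Fin d) ℝ}
    (hX : ∀ t, 0 ≤ t → (X t).PosSemidef)
    (hm : ∀ v, MonotoneOn (fun t => v ⬝ᵥ X t *ᵥ v) (Ici 0))
    (c : Fin d → ℝ) (hc : ∀ t, 0 ≤ t → ∀ i, X t i i ≤ c i) :
    ∃ Y, Tendsto X atTop (𝓝 Y) := by
  have hconv : ∀ (v : Fin d → ℝ) (B : ℝ), (∀ t, 0 ≤ t → v ⬝ᵥ X t *ᵥ v ≤ B) →
      ∃ l, Tendsto (fun t => v ⬝ᵥ X t *ᵥ v) atTop (𝓝 l) := fun v B hB => by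
    have hmono : Monotone fun t : ℝ => v ⬝ᵥ X (max t 0) *ᵥ v := fun s t hst =>
      hm v (le_max_right s 0) (le_max_right t 0) (max_le_max_right 0 hst)
    refine ⟨_, (tendsto_atTop_ciSup hmono ⟨B, ?_⟩).congr' ?_⟩
    · rintro _ ⟨t, rfl⟩
      exact hB _ (le_max_right _ _)
    · filter_upwards [eventually_ge_atTop 0] with t ht
      rw [max_eq_left ht]
  have hdiag : ∀ (Z : Matrix (Fin d) (Fin d) ℝ) i j,
      Pi.single i 1 ⬝ᵥ Z *ᵥ Pi.single j 1 = Z i j := fun Z i j => by simp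
  have hexp : ∀ t, 0 ≤ t → ∀ i j, (Pi.single i 1 + Pi.single j 1) ⬝ᵥ X t *ᵥ
      (Pi.single i 1 + Pi.single j 1) = X t i i + X t j j + 2 * X t i j := fun t ht i j => by
    simp only [Matrix.mulVec_add, dotProduct_add, add_dotProduct, hdiag]
    have : X t j i = X t i j := congrFun (congrFun (transpose_eq_of_posSemidef (hX t ht)) i) j
    rw [this]; ring
  have hd : ∀ i, ∃ l, Tendsto (fun t => X t i i) atTop (𝓝 l) := fun i => by
    obtain ⟨l, hl⟩ := hconv (Pi.single i 1) (c i) fun t ht => by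
      rw [hdiag]; exact hc t ht i
    exact ⟨l, hl.congr fun t => hdiag _ _ _⟩
  have ho : ∀ i j, ∃ l, Tendsto (fun t => X t i j) atTop (𝓝 l) := fun i j => by
    obtain ⟨l, hl⟩ := hconv (Pi.single i 1 + Pi.single j 1) (2 * c i + 2 * c j) fun t ht => by
      have h1 := quadForm_nonneg (hX t ht) (Pi.single i 1 - Pi.single j 1)
      simp only [Matrix.mulVec_sub, dotProduct_sub, sub_dotProduct, hdiag] at h1
      have : X t j i = X t i j := congrFun (congrFun (transpose_eq_of_posSemidef (hX t ht)) i) j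
      have h2 := hc t ht i
      have h3 := hc t ht j
      rw [hexp t ht]
      linarith
    obtain ⟨li, hli⟩ := hd i
    obtain ⟨lj, hlj⟩ := hd j
    refine ⟨_, (((hl.sub hli).sub hlj).div_const 2).congr' ?_⟩
    filter_upwards [eventually_ge_atTop 0] with t ht
    rw [hexp t ht]; ring
  choose Y hY using ho
  exact ⟨Matrix.of Y, tendsto_pi_nhds.2 fun i => tendsto_pi_nhds.2 fun j => hY i j⟩

end QuadForm

/-! ### Global existence and convergence of the Riccati flow -/

section Riccati

variable {d : ℕ}

/-- The right-hand side of the matrix Riccati equation `X' = q - Aᵀ X - X A - X R X`. -/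
def riccatiField (A R q X : Matrix (Fin d) (Fin d) ℝ) : Matrix (Fin d) (Fin d) ℝ :=
  q - Aᵀ * X - X * A - X * R * X

/-- Completing the square around `K`: the quadratic term becomes `-(X - K)ᵀ R (X - K)`, which is
nonpositive when `R` is positive semidefinite, and the linear part is governed by `D`. -/
theorem riccatiField_eq_of_feedback {A R q K D X : Matrix (Fin d) (Fin d) ℝ} (hR : Rᵀ = R)
    (hX : Xᵀ = X) (hK : A + R * K = D) :
    riccatiField A R q X
      = q + Kᵀ * R * K - Dᵀ * X - X * D - (X - K)ᵀ * R * (X - K) := by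
  simp only [riccatiField, ← hK, Matrix.transpose_add, Matrix.transpose_mul, Matrix.transpose_sub,
    hR, hX]
  noncomm_ring

/-- On the diagonal the linear terms are `-2 δᵢ Xᵢᵢ` and the square has a favourable sign, so a
nonnegative velocity bounds `Xᵢᵢ`. -/
theorem diag_le_of_riccatiField_posSemidef {A R q K X : Matrix (Fin d) (Fin d) ℝ} {δ : Fin d → ℝ}
    (hR : R.PosSemidef) (hX : Xᵀ = X) (hδ : ∀ i, 0 < δ i)
    (hK : A + R * K = Matrix.diagonal δ) (h : (riccatiField A R q X).PosSemidef) (i : Fin d) :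
    X i i ≤ (q + Kᵀ * R * K) i i / (2 * δ i) := by
  have h1 := h.diag_nonneg (i := i)
  have h2 := (hR.conjTranspose_mul_mul_same (X - K)).diag_nonneg (i := i)
  rw [Matrix.conjTranspose_eq_transpose_of_trivial] at h2
  rw [riccatiField_eq_of_feedback (transpose_eq_of_posSemidef hR) hX hK] at h1
  rw [le_div_iff₀ (by have := hδ i; positivity)]
  simp only [Matrix.sub_apply, Matrix.diagonal_transpose, Matrix.diagonal_mul,
    Matrix.mul_diagonal] at h1
  linarith

attribute [local instance] Matrix.linftyOpNormedRing Matrix.linftyOpNormedAlgebra in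
/-- Global existence for the matrix Riccati equation started at zero, together with a fundamental
matrix `U` of its linearisation. -/
theorem exists_riccati_solution {A R q : Matrix (Fin d) (Fin d) ℝ} (hR : R.PosSemidef)
    (hq : q.PosDef) :
    ∃ U X : ℝ → Matrix (Fin d) (Fin d) ℝ, X 0 = 0 ∧ ∀ t, 0 ≤ t →
      IsUnit (U t) ∧ (X t).PosSemidef ∧ HasDerivAt U ((A + R * X t) * U t) t ∧
      HasDerivAt X (riccatiField A R q (X t)) t ∧
      (riccatiField A R q (X t)).PosSemidef := by
  obtain ⟨U, V, hU0, hV0, hU, hV⟩ := exists_hamiltonian_flow A R q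
  have hRt := transpose_eq_of_posSemidef hR
  have hqt := transpose_eq_of_posSemidef hq.posSemidef
  refine ⟨U, fun t => V t * (U t)⁻¹, by simp [hV0], fun t ht => ?_⟩
  have hu := hamiltonian_flow_isUnit hR hq hU0 hV0 hU hV ht
  have hdet := (Matrix.isUnit_iff_isUnit_det _).1 hu
  set X := V t * (U t)⁻¹ with hX
  have hXU : X * U t = V t := by
    rw [hX, Matrix.mul_assoc, Matrix.nonsing_inv_mul _ hdet, Matrix.mul_one]
  have hUU := Matrix.mul_nonsing_inv _ hdet
  have hconj : ∀ Y : Matrix (Fin d) (Fin d) ℝ,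
      ((U t)⁻¹)ᵀ * ((U t)ᵀ * Y * U t) * (U t)⁻¹ = Y := fun Y => by
    have h1 : ((U t)⁻¹)ᵀ * (U t)ᵀ = 1 := by
      rw [← Matrix.transpose_mul, hUU, Matrix.transpose_one]
    calc _ = (((U t)⁻¹)ᵀ * (U t)ᵀ) * Y * (U t * (U t)⁻¹) := by noncomm_ring
      _ = Y := by rw [h1, hUU, Matrix.one_mul, Matrix.mul_one]
  have hsymm := hamiltonian_flow_symm hRt hqt hV0 hU hV t
  have hXt : Xᵀ = X := by
    refine (hconj Xᵀ).symm.trans (Eq.trans ?_ (hconj X))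
    congr 2
    rw [← Matrix.transpose_mul, hXU, Matrix.mul_assoc, hXU, hsymm]
  have hUX : (U t)ᵀ * X = (V t)ᵀ := by rw [← hXU, Matrix.transpose_mul, hXt]
  refine ⟨hu, ?_, ?_, ?_, ?_⟩
  · refine Matrix.PosSemidef.of_dotProduct_mulVec_nonneg hXt
      fun v => ?_
    have h1 := hamiltonian_flow_quadForm_monotone hR hq hU hV ((U t)⁻¹ *ᵥ v) ht
    simp only [Matrix.mulVec_mulVec, hV0, Matrix.zero_mul, Matrix.zero_mulVec, dotProduct_zero] at h1
    rw [hUU, Matrix.one_mulVec] at h1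
    simpa using h1
  · refine (hU t).congr_deriv ?_
    rw [Matrix.add_mul, Matrix.mul_assoc, hXU]
  · refine ((hV t).mul ((hU t).matrix_inv hu)).congr_deriv ?_
    have e1 : (q * U t - Aᵀ * V t) * (U t)⁻¹ = q - Aᵀ * X := by
      rw [Matrix.sub_mul, Matrix.mul_assoc, hUU, Matrix.mul_one, Matrix.mul_assoc, ← hX]
    have e2 : V t * -((U t)⁻¹ * (A * U t + R * V t) * (U t)⁻¹)
        = -(X * (A * (U t * (U t)⁻¹) + R * (V t * (U t)⁻¹))) := by
      rw [hX]; noncomm_ring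
    rw [e1, e2, hUU, ← hX]
    change _ = riccatiField A R q X
    rw [riccatiField]
    noncomm_ring
  -- The conserved quantity shows that the velocity of `X` is congruent to `q`.
  · have h1 : (U t)ᵀ * riccatiField A R q X * U t = q := by
      conv_rhs => rw [← hamiltonian_flow_conserved hRt hqt hU0 hV0 hU hV t]
      rw [riccatiField, ← hUX, ← hXU]
      noncomm_ring
    rw [← hconj (riccatiField A R q X), h1]
    simpa [Matrix.conjTranspose_eq_transpose_of_trivial] using
      hq.posSemidef.conjTranspose_mul_mul_same (U t)⁻¹

/-- On a kernel vector `v` of `X` every term containing `X` drops out of the equation, leaving `v ⬝ᵥ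
q v = 0`. -/
theorem posDef_of_riccatiField_eq_zero {A R q X : Matrix (Fin d) (Fin d) ℝ} (hq : q.PosDef)
    (hX : X.PosSemidef) (h : riccatiField A R q X = 0) : X.PosDef := by
  refine Matrix.PosDef.of_dotProduct_mulVec_pos hX.isHermitian fun v hv => ?_
  refine (hX.dotProduct_mulVec_nonneg v).lt_of_ne' fun h0 => ?_
  have hXv := (hX.dotProduct_mulVec_zero_iff v).1 h0
  have hXv' : v ᵥ* X = 0 := by
    rw [← Matrix.mulVec_transpose, transpose_eq_of_posSemidef hX, hXv]
  have h1 := congrArg (fun Y => v ⬝ᵥ Y *ᵥ v) h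
  simp only [riccatiField, Matrix.sub_mulVec, dotProduct_sub, ← Matrix.mulVec_mulVec, hXv,
    Matrix.mulVec_zero, dotProduct_zero, Matrix.zero_mulVec, sub_zero,
    Matrix.dotProduct_mulVec v X, hXv', zero_dotProduct] at h1
  exact (quadForm_pos hq hv).ne' h1

/-- At an equilibrium this matrix equals `q + Xᵀ R X`. Thus `X` itself is a Lyapunov matrix for the
closed-loop matrix `A + R X`. -/
theorem posDef_lyapunov_of_riccatiField_eq_zero {A R q X : Matrix (Fin d) (Fin d) ℝ}
    (hR : R.PosSemidef) (hq : q.PosDef) (hX : Xᵀ = X) (h : riccatiField A R q X = 0) :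
    (X * (A + R * X) + (A + R * X)ᵀ * X).PosDef := by
  have h1 : X * (A + R * X) + (A + R * X)ᵀ * X = q + Xᵀ * R * X := by
    have h2 : X * (A + R * X) + (A + R * X)ᵀ * X
        = q + X * R * X - riccatiField A R q X := by
      simp only [riccatiField, Matrix.transpose_add, Matrix.transpose_mul, hX,
        transpose_eq_of_posSemidef hR]
      noncomm_ring
    rw [h2, h, sub_zero, hX]
  rw [h1]
  refine hq.add_posSemidef ?_
  simpa [Matrix.conjTranspose_eq_transpose_of_trivial] using hR.conjTranspose_mul_mul_same X

theorem continuous_riccatiField (A R q : Matrix (Fin d) (Fin d) ℝ) :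
    Continuous (riccatiField A R q) := by
  unfold riccatiField
  fun_prop

attribute [local instance] Matrix.linftyOpNormedRing Matrix.linftyOpNormedAlgebra in
/-- The matrix Riccati equation and the attached linear equation, both started at zero, have global
solutions, and these converge if some feedback makes the system stable and diagonal. -/
theorem exists_convergent_riccati_flow {A R q K : Matrix (Fin d) (Fin d) ℝ} {δ : Fin d → ℝ}
    (hR : R.PosSemidef) (hq : q.PosDef) (hδ : ∀ i, 0 < δ i)
    (hK : A + R * K = Matrix.diagonal δ) (e f : Fin d → ℝ) :
    ∃ (X : ℝ → Matrix (Fin d) (Fin d) ℝ) (b : ℝ → Fin d → ℝ), X 0 = 0 ∧ b 0 = 0 ∧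
      (∀ t, 0 ≤ t → (X t)ᵀ = X t) ∧
      (∀ t, 0 ≤ t → ∀ i j, HasDerivAt (fun s => X s i j) (riccatiField A R q (X t) i j) t) ∧
      (∀ t, 0 ≤ t → HasDerivAt b (-((A + R * X t)ᵀ *ᵥ b t) - (X t *ᵥ e + f)) t) ∧
      (∃ Y, Tendsto X atTop (𝓝 Y)) ∧ ∃ c, Tendsto b atTop (𝓝 c) := by
  obtain ⟨U, X, hX0, h⟩ := exists_riccati_solution (A := A) hR hq
  have hXt : ∀ t, 0 ≤ t → (X t)ᵀ = X t := fun t ht => transpose_eq_of_posSemidef (h t ht).2.1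
  have hXd : ∀ t, 0 ≤ t → HasDerivAt X (riccatiField A R q (X t)) t :=
    fun t ht => (h t ht).2.2.2.1
  have hmono : ∀ v, MonotoneOn (fun t => v ⬝ᵥ X t *ᵥ v) (Ici 0) := fun v => by
    have hd : ∀ t, 0 ≤ t → HasDerivAt (fun t => v ⬝ᵥ X t *ᵥ v)
        (v ⬝ᵥ riccatiField A R q (X t) *ᵥ v) t := fun t ht => by
      simpa using (hasDerivAt_const t v).dotProduct
        ((hXd t ht).matrix_mulVec (hasDerivAt_const t v))
    refine monotoneOn_of_deriv_nonneg (convex_Ici 0)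
      (fun t ht => (hd t ht).continuousAt.continuousWithinAt)
      (fun t ht => (hd t (interior_subset ht)).differentiableAt.differentiableWithinAt)
      fun t ht => ?_
    rw [(hd t (interior_subset ht)).deriv]
    exact quadForm_nonneg (h t (interior_subset ht)).2.2.2.2 v
  obtain ⟨Y, hY⟩ := exists_tendsto_of_monotone_quadForm (fun t ht => (h t ht).2.1) hmono _
    fun t ht => diag_le_of_riccatiField_posSemidef hR (hXt t ht) hδ hK (h t ht).2.2.2.2
  have hYt : Yᵀ = Y := by
    refine tendsto_nhds_unique ?_ hY
    refine (((Continuous.matrix_transpose continuous_id).tendsto Y).comp hY).congr' ?_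
    filter_upwards [eventually_ge_atTop 0] with t ht using hXt t ht
  have hYpsd : Y.PosSemidef := by
    refine Matrix.PosSemidef.of_dotProduct_mulVec_nonneg (by simpa [Matrix.IsHermitian] using hYt)
      fun v => ?_
    have hc : Continuous fun Z : Matrix (Fin d) (Fin d) ℝ => star v ⬝ᵥ Z *ᵥ v := by fun_prop
    refine ge_of_tendsto ((hc.tendsto Y).comp hY) ?_
    filter_upwards [eventually_ge_atTop 0] with t ht
    exact (h t ht).2.1.dotProduct_mulVec_nonneg v
  have hY0 : riccatiField A R q Y = 0 := by
    ext i j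
    have hc : Continuous fun Z : Matrix (Fin d) (Fin d) ℝ => riccatiField A R q Z i j :=
      (continuous_riccatiField A R q).matrix_elem i j
    exact deriv_limit_eq_zero (fun t ht => hasDerivAt_matrix_iff.1 (hXd t ht) i j)
      (((continuous_id.matrix_elem i j).tendsto Y).comp hY) ((hc.tendsto Y).comp hY)
  have hXc : ContinuousOn X (Ici 0) := fun t ht => (hXd t ht).continuousAt.continuousWithinAt
  have hUc : ContinuousOn U (Ici 0) :=
    fun t ht => (h t ht).2.2.1.continuousAt.continuousWithinAt
  -- Variation of constants: since `U' = (A + R X) U`, the inverse transpose of `U` solves the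
  -- homogeneous equation for `b`.
  obtain ⟨y, hy0, hy⟩ := exists_primitive_of_continuousOn_Ici
    (g := fun t => (U t)ᵀ *ᵥ (X t *ᵥ e + f)) (by fun_prop)
  have hb : ∀ t, 0 ≤ t → HasDerivAt (fun t => -(((U t)⁻¹)ᵀ *ᵥ y t))
      (-((A + R * X t)ᵀ *ᵥ (-(((U t)⁻¹)ᵀ *ᵥ y t))) - (X t *ᵥ e + f)) t := fun t ht => by
    obtain ⟨hu, -, hUd, -, -⟩ := h t ht
    have hUU := Matrix.mul_nonsing_inv _ ((Matrix.isUnit_iff_isUnit_det _).1 hu)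
    refine ((hUd.matrix_inv hu).matrix_transpose.matrix_mulVec (hy t ht)).neg.congr_deriv ?_
    have e1 : (U t)⁻¹ * ((A + R * X t) * U t) * (U t)⁻¹ = (U t)⁻¹ * (A + R * X t) := by
      rw [Matrix.mul_assoc, Matrix.mul_assoc, hUU, Matrix.mul_one]
    have e2 : ((U t)⁻¹)ᵀ * (U t)ᵀ = 1 := by
      rw [← Matrix.transpose_mul, hUU, Matrix.transpose_one]
    rw [e1, Matrix.transpose_neg, Matrix.transpose_mul, Matrix.mulVec_mulVec _ _ (U t)ᵀ, e2,
      Matrix.one_mulVec, Matrix.neg_mulVec, Matrix.mulVec_neg, Matrix.mulVec_mulVec]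
    abel
  refine ⟨X, fun t => -(((U t)⁻¹)ᵀ *ᵥ y t), hX0, by simp [hy0], hXt,
    fun t ht => hasDerivAt_matrix_iff.1 (hXd t ht), hb, ⟨Y, hY⟩, ?_⟩
  have hcM : Continuous fun Z : Matrix (Fin d) (Fin d) ℝ => A + R * Z := by fun_prop
  have hcg : Continuous fun Z : Matrix (Fin d) (Fin d) ℝ => Z *ᵥ e + f := by fun_prop
  exact tendsto_of_lyapunov (posDef_of_riccatiField_eq_zero hq hYpsd hY0)
    (posDef_lyapunov_of_riccatiField_eq_zero hR hq hYt hY0) ((hcM.tendsto Y).comp hY)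
    ((hcg.tendsto Y).comp hY) hb

end Riccati

/-! ### Backward Gronwall inequality -/

noncomputable section

section Uniqueness

/-- Gronwall's inequality, backwards from a terminal time. -/
theorem eq_zero_of_norm_deriv_le {E : Type*} [NormedAddCommGroup E] [NormedSpace ℝ E]
    {f f' : ℝ → E} {κ : ℝ → ℝ} {T : ℝ}
    (hf : ∀ t ≤ T, HasDerivWithinAt f (f' t) (Iic T) t) (hκ : ContinuousOn κ (Iic T))
    (hle : ∀ t ≤ T, ‖f' t‖ ≤ κ t * ‖f t‖) (hT : f T = 0) : ∀ t ≤ T, f t = 0 := by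
  intro t₀ ht₀
  -- `κ` may be unbounded on the half-line; its bound on `[t₀, T]` is enough.
  obtain ⟨K, hK⟩ := isCompact_Icc.bddAbove_image (hκ.mono (Icc_subset_Iic_self : Icc t₀ T ⊆ Iic T))
  have hd : ∀ s, 0 ≤ s → HasDerivWithinAt (fun s => f (T - s)) (-f' (T - s)) (Ici s) s :=
    fun s hs => by
      have h1 : HasDerivWithinAt (fun s : ℝ => T - s) (-1) (Ici s) s :=
        ((hasDerivAt_id s).const_sub T).hasDerivWithinAt
      have h2 := (hf (T - s) (by linarith)).scomp s h1 fun x hx => by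
        have := mem_Ici.1 hx
        exact mem_Iic.2 (by linarith)
      simpa [Function.comp_def] using h2
  have h := norm_le_gronwallBound_of_norm_deriv_right_le (f := fun s => f (T - s)) (δ := 0)
    (K := K) (ε := 0) (a := 0) (b := T - t₀) ?_ (fun s hs => hd s hs.1) (by simp [hT]) ?_
    (T - t₀) ⟨sub_nonneg.2 ht₀, le_rfl⟩
  · simpa [gronwallBound_ε0_δ0] using h
  · have hc : ContinuousOn f (Iic T) := fun t ht => (hf t ht).continuousWithinAt
    exact hc.comp (by fun_prop) fun s hs => mem_Iic.2 (by linarith [hs.1])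
  · intro s hs
    have h1 := hle (T - s) (by linarith [hs.1])
    have h2 : κ (T - s) ≤ K :=
      hK ⟨T - s, ⟨by linarith [hs.2], by linarith [hs.1]⟩, rfl⟩
    simp only [norm_neg, add_zero]
    exact h1.trans (mul_le_mul_of_nonneg_right h2 (norm_nonneg _))

end Uniqueness

/-! ### The system of the market: coefficients, existence and uniqueness -/

namespace CointegratedMarket

variable {d m : ℕ} (M : CointegratedMarket d m)

theorem Sigma0_transpose : M.Sigma0ᵀ = M.Sigma0 := by
  simp [Sigma0, Matrix.transpose_mul]

theorem Sigma1_posDef : M.Sigma1.PosDef := M.posDef1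

theorem Sigma1_transpose : M.Sigma1ᵀ = M.Sigma1 := by
  simp [Sigma1, Matrix.transpose_mul]

theorem Sigma1_det_isUnit : IsUnit M.Sigma1.det := M.Sigma1_posDef.det_pos.ne'.isUnit

theorem Sigma1_inv_transpose : (M.Sigma1⁻¹)ᵀ = M.Sigma1⁻¹ := by
  rw [Matrix.transpose_nonsing_inv, Sigma1_transpose]

theorem delta_transpose : M.deltaᵀ = M.delta := Matrix.diagonal_transpose _

theorem beta_mul_Sigma0 : M.beta * M.Sigma0 = M.Psi1 * M.Psi0ᵀ := by
  have h : IsUnit M.Sigma0.det := (M.posDef0.det_pos).ne'.isUnit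
  rw [beta, Matrix.mul_assoc, Matrix.nonsing_inv_mul _ h, Matrix.mul_one]

theorem Psi1_mul_Psi0_mul_beta : M.Psi1 * M.Psi0ᵀ * M.betaᵀ = M.beta * M.Sigma0 * M.betaᵀ := by
  rw [beta_mul_Sigma0]

theorem beta_mul_Psi0_mul_Psi1 : M.beta * M.Psi0 * M.Psi1ᵀ = M.beta * M.Sigma0 * M.betaᵀ := by
  have h := congrArg Matrix.transpose M.Psi1_mul_Psi0_mul_beta
  simpa [Matrix.transpose_mul, Sigma0_transpose, Matrix.mul_assoc] using h

/-- `β` is the regression coefficient of the stocks on the factors, so both cross terms of `Σ₃`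
equal `β Σ₀ βᵀ`. -/
theorem Sigma3_eq_Sigma2 : M.Sigma3 = M.Sigma2 := by
  rw [Sigma3, Sigma2, beta_mul_Psi0_mul_Psi1, sub_add_cancel]

/-- `Σ₂` is the Gram matrix of the residual `Ψ₁ - β Ψ₀`. It may be singular. -/
theorem Sigma2_posSemidef : M.Sigma2.PosSemidef := by
  have h : M.Sigma2 = (M.Psi1 - M.beta * M.Psi0) * (M.Psi1 - M.beta * M.Psi0)ᵀ := by
    rw [← Sigma3_eq_Sigma2, Sigma3, Sigma1, Sigma0, Matrix.transpose_sub, Matrix.transpose_mul,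
      Matrix.sub_mul, Matrix.mul_sub, Matrix.mul_sub]
    simp only [Matrix.mul_assoc]
    abel
  rw [h, ← Matrix.conjTranspose_eq_transpose_of_trivial]
  exact Matrix.posSemidef_self_mul_conjTranspose _

theorem Sigma2_transpose : M.Sigma2ᵀ = M.Sigma2 :=
  transpose_eq_of_posSemidef M.Sigma2_posSemidef

theorem Sigma1_sub_Sigma2_posSemidef : (M.Sigma1 - M.Sigma2).PosSemidef := by
  rw [Sigma2, sub_sub_cancel, Psi1_mul_Psi0_mul_beta,
    ← Matrix.conjTranspose_eq_transpose_of_trivial]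
  exact Matrix.PosSemidef.mul_mul_conjTranspose_same M.posDef0.posSemidef _

/-- The quadratic coefficient of the Riccati equation. -/
def riccatiR (γ : ℝ) : Matrix (Fin d) (Fin d) ℝ :=
  (2 * γ / (1 - γ)) • (M.Sigma2ᵀ * M.Sigma1⁻¹ * M.Sigma2) + (2 : ℝ) • M.Sigma3

/-- The linear coefficient of the Riccati equation. -/
def riccatiA (γ : ℝ) : Matrix (Fin d) (Fin d) ℝ :=
  (γ / (1 - γ)) • (M.Sigma2ᵀ * M.Sigma1⁻¹ * M.delta) + M.delta

/-- The constant coefficient of the Riccati equation. -/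
def riccatiQ (γ : ℝ) : Matrix (Fin d) (Fin d) ℝ :=
  -(γ / (2 * (1 - γ))) • (M.delta * M.Sigma1⁻¹ * M.delta)

/-- The coefficient of `-C` in the inhomogeneity of the equation for `b`. -/
def sourceE (γ : ℝ) : Fin d → ℝ :=
  (2 * γ / (1 - γ)) • ((M.Sigma2ᵀ * M.Sigma1⁻¹) *ᵥ M.muEx) + (2 : ℝ) • (M.delta *ᵥ M.theta)

/-- The constant inhomogeneity of the equation for `b`. -/
def sourceF (γ : ℝ) : Fin d → ℝ := (γ / (1 - γ)) • ((M.delta * M.Sigma1⁻¹) *ᵥ M.muEx)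

theorem riccatiA_transpose (γ : ℝ) :
    (M.riccatiA γ)ᵀ = (γ / (1 - γ)) • (M.delta * M.Sigma1⁻¹ * M.Sigma2) + M.delta := by
  simp [riccatiA, Matrix.transpose_mul, delta_transpose, Sigma1_inv_transpose, Matrix.mul_assoc]

theorem rhsC_eq (γ : ℝ) (C : Matrix (Fin d) (Fin d) ℝ) :
    M.rhsC γ C = -(C * M.riccatiR γ * C) + C * M.riccatiA γ + (M.riccatiA γ)ᵀ * C
      + M.riccatiQ γ := by
  rw [rhsC, riccatiR, riccatiA, riccatiQ, neg_smul, sub_eq_add_neg]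

/-- The sign change makes the constant term positive definite for `γ < 0`; time reversal supplies
the remaining sign. -/
theorem rhsC_neg (γ : ℝ) (X : Matrix (Fin d) (Fin d) ℝ) :
    M.rhsC γ (-X) = riccatiField (M.riccatiA γ) (M.riccatiR γ) (M.riccatiQ γ) X := by
  rw [rhsC_eq, riccatiField]
  noncomm_ring

theorem rhsB_eq (γ : ℝ) (b : Fin d → ℝ) (C : Matrix (Fin d) (Fin d) ℝ) :
    M.rhsB γ b C = ((M.riccatiA γ)ᵀ - C * M.riccatiR γ) *ᵥ b - C *ᵥ M.sourceE γ
      + M.sourceF γ := by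
  rw [rhsB, riccatiR, riccatiA_transpose, sourceE, sourceF, Matrix.sub_mulVec]
  abel

/-- From `0 ≤ Σ₂ ≤ Σ₁` follows `0 ≤ Σ₂ Σ₁⁻¹ Σ₂ ≤ Σ₂`, and the coefficient `2 γ / (1 - γ)` lies above
`-2`. The upper bound is the sum of the forms of `Σ₂` at `y - v` and of `Σ₁ - Σ₂` at `y = Σ₁⁻¹ Σ₂
v`. -/
theorem riccatiR_posSemidef {γ : ℝ} (hγ : γ < 0) : (M.riccatiR γ).PosSemidef := by
  have hS := M.Sigma2_transpose
  have h1γ : 0 < 1 - γ := by linarith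
  refine Matrix.PosSemidef.of_dotProduct_mulVec_nonneg ?_ fun v => ?_
  · have : (M.riccatiR γ)ᵀ = M.riccatiR γ := by
      simp [riccatiR, Sigma3_eq_Sigma2, Matrix.transpose_mul, hS, Sigma1_inv_transpose,
        Matrix.mul_assoc]
    exact this
  set y := (M.Sigma1⁻¹ * M.Sigma2) *ᵥ v with hy
  have hSy : M.Sigma1 *ᵥ y = M.Sigma2 *ᵥ v := by
    rw [hy, Matrix.mulVec_mulVec, ← Matrix.mul_assoc, Matrix.mul_nonsing_inv _ M.Sigma1_det_isUnit,
      Matrix.one_mul]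
  have h1 := quadForm_nonneg M.Sigma2_posSemidef (y - v)
  have h2 := quadForm_nonneg M.Sigma1_sub_Sigma2_posSemidef y
  have h3 := quadForm_nonneg M.Sigma2_posSemidef v
  have h4 := dotProduct_mulVec_comm_of_transpose_eq hS v y
  simp only [Matrix.sub_mulVec, Matrix.mulVec_sub, dotProduct_sub, sub_dotProduct, hSy] at h1 h2
  have h5 : v ⬝ᵥ M.riccatiR γ *ᵥ v
      = 2 * γ / (1 - γ) * (y ⬝ᵥ M.Sigma2 *ᵥ v) + 2 * (v ⬝ᵥ M.Sigma2 *ᵥ v) := by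
    rw [riccatiR, Sigma3_eq_Sigma2, hS, Matrix.add_mulVec, Matrix.smul_mulVec, Matrix.smul_mulVec,
      dotProduct_add, dotProduct_smul, dotProduct_smul, Matrix.mul_assoc, ← Matrix.mulVec_mulVec,
      ← hy, h4, smul_eq_mul, smul_eq_mul]
  rw [star_trivial, h5]
  have h6 : 2 * γ / (1 - γ) = 2 / (1 - γ) - 2 := by field_simp; ring
  have h7 : 0 ≤ 2 / (1 - γ) * (y ⬝ᵥ M.Sigma2 *ᵥ v) := by
    have h8 := quadForm_nonneg M.Sigma2_posSemidef y
    have : 0 ≤ y ⬝ᵥ M.Sigma2 *ᵥ v := by linarith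
    positivity
  rw [h6]
  linarith

theorem riccatiQ_posDef {γ : ℝ} (hγ : γ < 0) : (M.riccatiQ γ).PosDef := by
  have hc : 0 < -(γ / (2 * (1 - γ))) :=
    neg_pos.2 (div_neg_of_neg_of_pos hγ (by linarith))
  have hinj : Function.Injective M.delta.mulVec :=
    Matrix.mulVec_injective_of_isUnit <| by
      rw [Matrix.isUnit_iff_isUnit_det, delta, Matrix.det_diagonal]
      exact (Finset.prod_pos fun i _ => M.speed_pos i).ne'.isUnit
  have h := M.Sigma1_posDef.inv.conjTranspose_mul_mul_same hinj
  rw [Matrix.conjTranspose_eq_transpose_of_trivial, delta_transpose] at h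
  exact h.smul hc

/-- With `κ = γ / (1 - γ)`, `R = 2 Σ₂ Σ₁⁻¹ (Σ₁ + κ Σ₂)` and `A = δ + κ Σ₂ Σ₁⁻¹ δ` share the factor
`Σ₂ Σ₁⁻¹`. Hence `R K` can cancel the second term of `A` even if `Σ₂` is singular. This needs `Σ₁ +
κ Σ₂` invertible, which holds because `-1 < κ < 0`. -/
theorem exists_stabilizing_feedback {γ : ℝ} (hγ : γ < 0) :
    ∃ K, M.riccatiA γ + M.riccatiR γ * K = Matrix.diagonal M.speed := by
  have h1γ : 0 < 1 - γ := by linarith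
  set κ := γ / (1 - γ) with hκ
  have hN : (M.Sigma1 + κ • M.Sigma2).PosDef := by
    have : M.Sigma1 + κ • M.Sigma2
        = (1 / (1 - γ)) • M.Sigma1 + (-κ) • (M.Sigma1 - M.Sigma2) := by
      have : (1 : ℝ) = 1 / (1 - γ) + -κ := by rw [hκ]; field_simp; ring
      calc M.Sigma1 + κ • M.Sigma2 = (1 / (1 - γ) + -κ) • M.Sigma1 + κ • M.Sigma2 := by
            rw [← this, one_smul]
        _ = _ := by
            rw [smul_sub, add_smul, neg_smul, neg_smul]
            abel
    rw [this]
    refine (M.Sigma1_posDef.smul (by positivity)).add_posSemidef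
      (M.Sigma1_sub_Sigma2_posSemidef.smul ?_)
    exact neg_nonneg.2 (div_neg_of_neg_of_pos hγ h1γ).le
  have hNdet : IsUnit (M.Sigma1 + κ • M.Sigma2).det := hN.det_pos.ne'.isUnit
  have hR : M.riccatiR γ
      = (2 : ℝ) • (M.Sigma2 * M.Sigma1⁻¹ * (M.Sigma1 + κ • M.Sigma2)) := by
    rw [riccatiR, Sigma3_eq_Sigma2, Sigma2_transpose, Matrix.mul_add, Matrix.mul_assoc _ _ M.Sigma1,
      Matrix.nonsing_inv_mul _ M.Sigma1_det_isUnit, Matrix.mul_one, Matrix.mul_smul, smul_add,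
      smul_smul, hκ, mul_div_assoc, add_comm]
  refine ⟨(-(κ / 2)) • ((M.Sigma1 + κ • M.Sigma2)⁻¹ * M.delta), ?_⟩
  rw [hR, Matrix.smul_mul, Matrix.mul_smul, smul_smul, Matrix.mul_assoc,
    ← Matrix.mul_assoc _ _ M.delta, Matrix.mul_nonsing_inv _ hNdet, Matrix.one_mul, riccatiA,
    Sigma2_transpose, ← hκ, show (2 : ℝ) * -(κ / 2) = -κ by ring, neg_smul]
  change _ = M.delta
  abel

theorem continuous_rhsA (γ : ℝ) :
    Continuous fun p : (Fin d → ℝ) × Matrix (Fin d) (Fin d) ℝ => M.rhsA γ p.1 p.2 := by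
  unfold rhsA
  fun_prop

theorem solvesODE_of_riccati_flow {γ T : ℝ} {X : ℝ → Matrix (Fin d) (Fin d) ℝ}
    {b : ℝ → Fin d → ℝ} {a : ℝ → ℝ} (hX0 : X 0 = 0) (hb0 : b 0 = 0) (ha0 : a 0 = 0)
    (hX : ∀ t, 0 ≤ t → ∀ i j, HasDerivAt (fun s => X s i j)
      (riccatiField (M.riccatiA γ) (M.riccatiR γ) (M.riccatiQ γ) (X t) i j) t)
    (hb : ∀ t, 0 ≤ t → HasDerivAt b (-((M.riccatiA γ + M.riccatiR γ * X t)ᵀ *ᵥ b t)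
      - (X t *ᵥ M.sourceE γ + M.sourceF γ)) t)
    (hXt : ∀ t, 0 ≤ t → (X t)ᵀ = X t) (hR : (M.riccatiR γ)ᵀ = M.riccatiR γ)
    (ha : ∀ t, 0 ≤ t → HasDerivAt a (-M.rhsA γ (b t) (-X t)) t) :
    M.SolvesODE γ T (fun t => a (T - t)) (fun t => b (T - t)) (fun t => -X (T - t)) where
  deriv_a t ht := by
    simpa using (HasDerivAt.comp_const_sub T t (ha (T - t) (sub_nonneg.2 ht))).hasDerivWithinAt
  terminal_a := by simpa using ha0
  deriv_b t ht := by
    refine ((HasDerivAt.comp_const_sub T t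
      (hb (T - t) (sub_nonneg.2 ht))).congr_deriv ?_).hasDerivWithinAt
    rw [rhsB_eq, Matrix.transpose_add, Matrix.transpose_mul, hXt _ (sub_nonneg.2 ht), hR,
      Matrix.neg_mul, sub_neg_eq_add, Matrix.neg_mulVec]
    abel
  terminal_b := by simpa using hb0
  deriv_C t ht i j := by
    refine ((HasDerivAt.comp_const_sub T t
      (hX (T - t) (sub_nonneg.2 ht) i j)).neg.congr_deriv ?_).hasDerivWithinAt
    rw [rhsC_neg, neg_neg]
  terminal_C := by simp [hX0]

attribute [local instance] Matrix.linftyOpNormedRing Matrix.linftyOpNormedAlgebra in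
theorem SolvesODE.unique {γ T : ℝ} {a a' : ℝ → ℝ} {b b' : ℝ → Fin d → ℝ}
    {C C' : ℝ → Matrix (Fin d) (Fin d) ℝ} (h : M.SolvesODE γ T a b C)
    (h' : M.SolvesODE γ T a' b' C') :
    EqOn a' a (Iic T) ∧ EqOn b' b (Iic T) ∧ EqOn C' C (Iic T) := by
  have hCd : ∀ t ≤ T, HasDerivWithinAt C (M.rhsC γ (C t)) (Iic T) t := fun t ht =>
    hasDerivWithinAt_matrix_iff.2 (h.deriv_C t ht)
  have hCd' : ∀ t ≤ T, HasDerivWithinAt C' (M.rhsC γ (C' t)) (Iic T) t := fun t ht =>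
    hasDerivWithinAt_matrix_iff.2 (h'.deriv_C t ht)
  have hCc : ContinuousOn C (Iic T) := fun t ht => (hCd t ht).continuousWithinAt
  have hCc' : ContinuousOn C' (Iic T) := fun t ht => (hCd' t ht).continuousWithinAt
  have hC : EqOn C' C (Iic T) := fun t ht => sub_eq_zero.1 <| by
    refine eq_zero_of_norm_deriv_le (f := fun t => C' t - C t)
      (κ := fun t => ‖M.riccatiR γ‖ * ‖C' t‖ + ‖C t‖ * ‖M.riccatiR γ‖ + ‖M.riccatiA γ‖
        + ‖(M.riccatiA γ)ᵀ‖) (fun t ht => (hCd' t ht).sub (hCd t ht)) (by fun_prop) ?_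
      (by simp [h.terminal_C, h'.terminal_C]) t ht
    intro t _
    set D := C' t - C t
    -- The difference of two Riccati solutions solves a linear equation whose coefficients involve
    -- the solutions, which are continuous. No symmetry of `C` or `C'` is used.
    have e : M.rhsC γ (C' t) - M.rhsC γ (C t) = -(D * (M.riccatiR γ * C' t))
        - C t * M.riccatiR γ * D + D * M.riccatiA γ + (M.riccatiA γ)ᵀ * D := by
      simp only [rhsC_eq, D]
      noncomm_ring
    rw [e]
    refine (norm_add_le _ _).trans ?_
    refine (add_le_add ((norm_add_le _ _).trans
      (add_le_add (norm_sub_le _ _) (norm_mul_le _ _))) (norm_mul_le _ _)).trans ?_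
    have h1 : ‖-(D * (M.riccatiR γ * C' t))‖ ≤ ‖D‖ * (‖M.riccatiR γ‖ * ‖C' t‖) := by
      rw [norm_neg]
      exact (norm_mul_le _ _).trans (by gcongr; exact norm_mul_le _ _)
    have h2 : ‖C t * M.riccatiR γ * D‖ ≤ ‖C t‖ * ‖M.riccatiR γ‖ * ‖D‖ :=
      (norm_mul_le _ _).trans (by gcongr; exact norm_mul_le _ _)
    linarith
  have hb : EqOn b' b (Iic T) := fun t ht => sub_eq_zero.1 <| by
    refine eq_zero_of_norm_deriv_le (f := fun t => b' t - b t)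
      (κ := fun t => ‖(M.riccatiA γ)ᵀ - C t * M.riccatiR γ‖)
      (fun t ht => (h'.deriv_b t ht).sub (h.deriv_b t ht)) (by fun_prop) ?_
      (by simp [h.terminal_b, h'.terminal_b]) t ht
    intro t ht
    have e : M.rhsB γ (b' t) (C' t) - M.rhsB γ (b t) (C t)
        = ((M.riccatiA γ)ᵀ - C t * M.riccatiR γ) *ᵥ (b' t - b t) := by
      rw [hC ht, rhsB_eq, rhsB_eq, Matrix.mulVec_sub]
      abel
    rw [e]
    exact Matrix.linfty_opNorm_mulVec _ _
  refine ⟨fun t ht => sub_eq_zero.1 ?_, hb, hC⟩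
  refine eq_zero_of_norm_deriv_le (f := fun t => a' t - a t) (κ := fun _ => 0)
    (fun t ht => (h'.deriv_a t ht).sub (h.deriv_a t ht)) (by fun_prop) ?_
    (by simp [h.terminal_a, h'.terminal_a]) t ht
  intro t ht
  simp [hC ht, hb ht]

end CointegratedMarket

end

/-! ### Derivatives of the exponential-quadratic function and the pointwise maximum -/

noncomputable section

section Calculus

variable {d : ℕ}

theorem gradZ_eq {f : (Fin d → ℝ) → ℝ} {z G : Fin d → ℝ} (hf : DifferentiableAt ℝ f z)
    (h : ∀ i, HasDerivAt (fun s : ℝ => f (z + s • Pi.single i 1)) (G i) 0) : gradZ f z = G := by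
  ext i
  rw [gradZ, ← hf.lineDeriv_eq_fderiv, lineDeriv, (h i).deriv]

theorem contDiff_dotProduct_mulVec (b : Fin d → ℝ) (C : Matrix (Fin d) (Fin d) ℝ) (a : ℝ)
    {n : WithTop ℕ∞} : ContDiff ℝ n fun z : Fin d → ℝ => a + b ⬝ᵥ z + z ⬝ᵥ C *ᵥ z := by
  unfold dotProduct Matrix.mulVec dotProduct
  fun_prop

theorem hasDerivAt_line (z v : Fin d → ℝ) : HasDerivAt (fun s : ℝ => z + s • v) v 0 := by
  simpa using ((hasDerivAt_id (0 : ℝ)).smul_const v).const_add z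

theorem hasDerivAt_quadratic_line {C : Matrix (Fin d) (Fin d) ℝ} (hC : Cᵀ = C) (a : ℝ)
    (b z v : Fin d → ℝ) :
    HasDerivAt (fun s : ℝ => a + b ⬝ᵥ (z + s • v) + (z + s • v) ⬝ᵥ C *ᵥ (z + s • v))
      ((b + (2 : ℝ) • C *ᵥ z) ⬝ᵥ v) 0 := by
  have h := hasDerivAt_line z v
  have h1 := (((hasDerivAt_const (0 : ℝ) b).dotProduct h).const_add a).add
    (h.dotProduct (h.const_mulVec C))
  refine h1.congr_deriv ?_
  have h2 := dotProduct_mulVec_comm_of_transpose_eq hC z v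
  simp only [zero_smul, add_zero, zero_dotProduct, zero_add, add_dotProduct, smul_dotProduct,
    smul_eq_mul, h2, dotProduct_comm (C *ᵥ z) v]
  ring

theorem gradZ_exp_quadratic {C : Matrix (Fin d) (Fin d) ℝ} (hC : Cᵀ = C) (c a : ℝ)
    (b z : Fin d → ℝ) :
    gradZ (fun y => c * Real.exp (a + b ⬝ᵥ y + y ⬝ᵥ C *ᵥ y)) z
      = (c * Real.exp (a + b ⬝ᵥ z + z ⬝ᵥ C *ᵥ z)) • (b + (2 : ℝ) • C *ᵥ z) := by
  have hd := (contDiff_dotProduct_mulVec b C a (n := 1)).differentiable one_ne_zero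
  refine gradZ_eq ((hd z).exp.const_mul c) fun i => ?_
  refine ((hasDerivAt_quadratic_line hC a b z (Pi.single i 1)).exp.const_mul c).congr_deriv ?_
  simp only [zero_smul, add_zero, dotProduct_single, mul_one, Pi.smul_apply, smul_eq_mul]
  ring

theorem hessZ_exp_quadratic {C : Matrix (Fin d) (Fin d) ℝ} (hC : Cᵀ = C) (c a : ℝ)
    (b z : Fin d → ℝ) :
    hessZ (fun y => c * Real.exp (a + b ⬝ᵥ y + y ⬝ᵥ C *ᵥ y)) z
      = (c * Real.exp (a + b ⬝ᵥ z + z ⬝ᵥ C *ᵥ z)) • ((2 : ℝ) • C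
        + Matrix.vecMulVec (b + (2 : ℝ) • C *ᵥ z) (b + (2 : ℝ) • C *ᵥ z)) := by
  ext i j
  simp only [hessZ, Matrix.of_apply]
  have hd := (contDiff_dotProduct_mulVec b C a (n := 1)).differentiable one_ne_zero
  have hl : Differentiable ℝ fun y : Fin d → ℝ => (b + (2 : ℝ) • C *ᵥ y) j := by
    simp only [Pi.add_apply, Pi.smul_apply, Matrix.mulVec, dotProduct]
    fun_prop
  have e : (fun y => gradZ (fun y => c * Real.exp (a + b ⬝ᵥ y + y ⬝ᵥ C *ᵥ y)) y j)
      = fun y => c * Real.exp (a + b ⬝ᵥ y + y ⬝ᵥ C *ᵥ y) * (b + (2 : ℝ) • C *ᵥ y) j := by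
    ext y
    rw [gradZ_exp_quadratic hC]
    rfl
  rw [e]
  refine congrFun (gradZ_eq (G := fun i => (c * Real.exp (a + b ⬝ᵥ z + z ⬝ᵥ C *ᵥ z)) *
    (2 * C i j + (b + (2 : ℝ) • C *ᵥ z) i * (b + (2 : ℝ) • C *ᵥ z) j))
    (((hd z).exp.const_mul c).mul (hl z)) fun i => ?_) i
  have h1 := (hasDerivAt_quadratic_line hC a b z (Pi.single i 1)).exp.const_mul c
  have h2 : HasDerivAt (fun s : ℝ => (b + (2 : ℝ) • C *ᵥ (z + s • Pi.single i 1)) j)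
      (2 * C i j) 0 := by
    have := hasDerivAt_pi.1
      ((((hasDerivAt_line z (Pi.single i 1)).const_mulVec C).const_smul (2 : ℝ)).const_add b) j
    refine this.congr_deriv ?_
    have hij : C j i = C i j := congrFun (congrFun hC i) j
    simp [hij]
  refine (h1.mul h2).congr_deriv ?_
  simp only [zero_smul, add_zero, dotProduct_single, mul_one]
  ring

theorem dotProduct_symm_mul_mulVec {P : Matrix (Fin d) (Fin d) ℝ} (hP : Pᵀ = P)
    (N : Matrix (Fin d) (Fin d) ℝ) (x y : Fin d → ℝ) :
    x ⬝ᵥ (P * N) *ᵥ y = (P *ᵥ x) ⬝ᵥ N *ᵥ y := by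
  conv_lhs => rw [← hP]
  exact dotProduct_transpose_mul_mulVec P N x y

theorem deriv_rpow_mul {γ : ℝ} (hγ : γ ≠ 0) (E : ℝ) {w : ℝ} (hw : 0 < w) :
    deriv (fun x : ℝ => 1 / γ * x ^ γ * E) w = w ^ (γ - 1) * E := by
  have h := ((Real.hasDerivAt_rpow_const (p := γ) (Or.inl hw.ne')).const_mul (1 / γ)).mul_const E
  rw [h.deriv]
  field_simp

theorem iteratedDeriv_two_rpow_mul {γ : ℝ} (hγ : γ ≠ 0) (E : ℝ) {w : ℝ} (hw : 0 < w) :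
    iteratedDeriv 2 (fun x : ℝ => 1 / γ * x ^ γ * E) w = (γ - 1) * w ^ (γ - 2) * E := by
  rw [iteratedDeriv_succ, iteratedDeriv_one]
  have h1 : deriv (fun x : ℝ => 1 / γ * x ^ γ * E) =ᶠ[𝓝 w] fun x => x ^ (γ - 1) * E := by
    filter_upwards [lt_mem_nhds hw] with x hx using deriv_rpow_mul hγ E hx
  rw [h1.deriv_eq]
  have h := (Real.hasDerivAt_rpow_const (p := γ - 1) (Or.inl hw.ne')).mul_const E
  rw [h.deriv, sub_sub, one_add_one_eq_two]

/-- Maximum of a strictly concave quadratic function. -/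
theorem isGreatest_concave_quadratic {S : Matrix (Fin d) (Fin d) ℝ} (hS : S.PosDef) {c : ℝ}
    (hc : 0 < c) (h : Fin d → ℝ) :
    IsGreatest (range fun π : Fin d → ℝ => π ⬝ᵥ h - c / 2 * (π ⬝ᵥ S *ᵥ π))
      (1 / (2 * c) * (h ⬝ᵥ S⁻¹ *ᵥ h)) := by
  have hdet : IsUnit S.det := hS.det_pos.ne'.isUnit
  have hSt := transpose_eq_of_posSemidef hS.posSemidef
  have hSh : S *ᵥ (S⁻¹ *ᵥ h) = h := by
    rw [Matrix.mulVec_mulVec, Matrix.mul_nonsing_inv _ hdet, Matrix.one_mulVec]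
  -- Completing the square around the maximiser `c⁻¹ S⁻¹ h`.
  have key : ∀ π, π ⬝ᵥ h - c / 2 * (π ⬝ᵥ S *ᵥ π) = 1 / (2 * c) * (h ⬝ᵥ S⁻¹ *ᵥ h)
      - c / 2 * ((π - c⁻¹ • S⁻¹ *ᵥ h) ⬝ᵥ S *ᵥ (π - c⁻¹ • S⁻¹ *ᵥ h)) := fun π => by
    have h1 : (S⁻¹ *ᵥ h) ⬝ᵥ S *ᵥ π = π ⬝ᵥ h := by
      rw [dotProduct_mulVec_comm_of_transpose_eq hSt, hSh]
    simp only [Matrix.mulVec_sub, Matrix.mulVec_smul, hSh, sub_dotProduct, dotProduct_sub,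
      smul_dotProduct, dotProduct_smul, smul_eq_mul, h1, dotProduct_comm (S⁻¹ *ᵥ h) h]
    field_simp
    ring
  refine ⟨⟨c⁻¹ • S⁻¹ *ᵥ h, by simp only [key]; simp⟩, ?_⟩
  rintro _ ⟨π, rfl⟩
  simp only [key]
  have := quadForm_nonneg hS.posSemidef (π - c⁻¹ • S⁻¹ *ᵥ h)
  have : 0 ≤ c / 2 * ((π - c⁻¹ • S⁻¹ *ᵥ h) ⬝ᵥ S *ᵥ (π - c⁻¹ • S⁻¹ *ᵥ h)) := by positivity
  linarith

end Calculus

/-! ### The Hamilton-Jacobi-Bellman equation -/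

namespace CointegratedMarket

variable {d m : ℕ} (M : CointegratedMarket d m)

theorem dotProduct_riccatiR_mulVec (γ : ℝ) (x y : Fin d → ℝ) :
    x ⬝ᵥ M.riccatiR γ *ᵥ y = 2 * (γ / (1 - γ)) *
        ((M.Sigma2 *ᵥ x) ⬝ᵥ M.Sigma1⁻¹ *ᵥ (M.Sigma2 *ᵥ y)) + 2 * (x ⬝ᵥ M.Sigma2 *ᵥ y) := by
  rw [riccatiR, Sigma3_eq_Sigma2, Sigma2_transpose, Matrix.add_mulVec, dotProduct_add,
    Matrix.smul_mulVec, Matrix.smul_mulVec, dotProduct_smul, dotProduct_smul, Matrix.mul_assoc,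
    dotProduct_symm_mul_mulVec M.Sigma2_transpose, ← Matrix.mulVec_mulVec, smul_eq_mul,
    smul_eq_mul, mul_div_assoc]

theorem dotProduct_riccatiA_mulVec (γ : ℝ) (x z : Fin d → ℝ) :
    x ⬝ᵥ M.riccatiA γ *ᵥ z = γ / (1 - γ) *
        ((M.Sigma2 *ᵥ x) ⬝ᵥ M.Sigma1⁻¹ *ᵥ (M.delta *ᵥ z)) + x ⬝ᵥ M.delta *ᵥ z := by
  rw [riccatiA, Sigma2_transpose, Matrix.add_mulVec, dotProduct_add, Matrix.smul_mulVec,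
    dotProduct_smul, Matrix.mul_assoc, dotProduct_symm_mul_mulVec M.Sigma2_transpose,
    ← Matrix.mulVec_mulVec, smul_eq_mul]

theorem rhsA_eq (γ : ℝ) (b : Fin d → ℝ) (C : Matrix (Fin d) (Fin d) ℝ) :
    M.rhsA γ b C = -(γ / (1 - γ) / 2 * ((M.Sigma2 *ᵥ b) ⬝ᵥ M.Sigma1⁻¹ *ᵥ (M.Sigma2 *ᵥ b))
        + 1 / 2 * (b ⬝ᵥ M.Sigma2 *ᵥ b))
      - γ / (1 - γ) * (M.muEx ⬝ᵥ M.Sigma1⁻¹ *ᵥ (M.Sigma2 *ᵥ b)) - M.theta ⬝ᵥ M.delta *ᵥ b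
      - γ / (1 - γ) / 2 * (M.muEx ⬝ᵥ M.Sigma1⁻¹ *ᵥ M.muEx) - (M.Sigma2 * C).trace - M.r * γ := by
  have hk : γ / (2 * (1 - γ)) = γ / (1 - γ) / 2 := by rw [mul_comm, div_div]
  rw [rhsA, Sigma3_eq_Sigma2, Sigma2_transpose, hk, Matrix.add_mulVec, dotProduct_add,
    Matrix.smul_mulVec, Matrix.smul_mulVec, dotProduct_smul, dotProduct_smul, Matrix.mul_assoc,
    dotProduct_symm_mul_mulVec M.Sigma2_transpose, ← Matrix.mulVec_mulVec,
    dotProduct_symm_mul_mulVec M.Sigma2_transpose, smul_eq_mul, smul_eq_mul,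
    dotProduct_mulVec_comm_of_transpose_eq M.Sigma1_inv_transpose (M.Sigma2 *ᵥ b) M.muEx]
  ring

theorem rhsB_dotProduct (γ : ℝ) (b z : Fin d → ℝ) {C : Matrix (Fin d) (Fin d) ℝ} (hC : Cᵀ = C) :
    M.rhsB γ b C ⬝ᵥ z = b ⬝ᵥ M.riccatiA γ *ᵥ z - (C *ᵥ z) ⬝ᵥ M.riccatiR γ *ᵥ b
      - (2 * (γ / (1 - γ)) * ((M.Sigma2 *ᵥ (C *ᵥ z)) ⬝ᵥ M.Sigma1⁻¹ *ᵥ M.muEx)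
        + 2 * (M.theta ⬝ᵥ M.delta *ᵥ (C *ᵥ z)))
      + γ / (1 - γ) * (M.muEx ⬝ᵥ M.Sigma1⁻¹ *ᵥ (M.delta *ᵥ z)) := by
  have h1 : z ⬝ᵥ (M.riccatiA γ)ᵀ *ᵥ b = b ⬝ᵥ M.riccatiA γ *ᵥ z := by
    rw [Matrix.dotProduct_mulVec, Matrix.vecMul_transpose, dotProduct_comm]
  rw [dotProduct_comm, rhsB_eq, dotProduct_add, dotProduct_sub, Matrix.sub_mulVec, dotProduct_sub,
    h1, dotProduct_symm_mul_mulVec hC, dotProduct_mulVec_comm_of_transpose_eq hC z,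
    dotProduct_comm _ (C *ᵥ z), sourceE, sourceF, dotProduct_add, dotProduct_smul, dotProduct_smul,
    dotProduct_smul, Sigma2_transpose, dotProduct_symm_mul_mulVec M.Sigma2_transpose,
    dotProduct_symm_mul_mulVec M.delta_transpose,
    dotProduct_mulVec_comm_of_transpose_eq M.delta_transpose (C *ᵥ z),
    dotProduct_mulVec_comm_of_transpose_eq M.Sigma1_inv_transpose (M.delta *ᵥ z), smul_eq_mul,
    smul_eq_mul, smul_eq_mul, mul_div_assoc]

theorem quadForm_rhsC (γ : ℝ) (z : Fin d → ℝ) {C : Matrix (Fin d) (Fin d) ℝ} (hC : Cᵀ = C) :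
    z ⬝ᵥ M.rhsC γ C *ᵥ z = -((C *ᵥ z) ⬝ᵥ M.riccatiR γ *ᵥ (C *ᵥ z))
      + 2 * ((C *ᵥ z) ⬝ᵥ M.riccatiA γ *ᵥ z)
      - γ / (1 - γ) / 2 * ((M.delta *ᵥ z) ⬝ᵥ M.Sigma1⁻¹ *ᵥ (M.delta *ᵥ z)) := by
  have hk : γ / (2 * (1 - γ)) = γ / (1 - γ) / 2 := by rw [mul_comm, div_div]
  have h1 : z ⬝ᵥ ((M.riccatiA γ)ᵀ * C) *ᵥ z = (C *ᵥ z) ⬝ᵥ M.riccatiA γ *ᵥ z := by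
    rw [dotProduct_transpose_mul_mulVec, dotProduct_comm]
  rw [rhsC_eq, riccatiQ, hk, Matrix.add_mulVec, Matrix.add_mulVec, Matrix.add_mulVec,
    dotProduct_add, dotProduct_add, dotProduct_add, h1, Matrix.neg_mulVec, dotProduct_neg,
    Matrix.mul_assoc, dotProduct_symm_mul_mulVec hC, ← Matrix.mulVec_mulVec,
    dotProduct_symm_mul_mulVec hC, Matrix.smul_mulVec, dotProduct_smul, Matrix.mul_assoc,
    dotProduct_symm_mul_mulVec M.delta_transpose, ← Matrix.mulVec_mulVec, smul_eq_mul]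
  ring

/-- The Hamilton-Jacobi-Bellman equation, divided by the value function. -/
theorem reduced_hjb (γ : ℝ) (b z : Fin d → ℝ) {C : Matrix (Fin d) (Fin d) ℝ} (hC : Cᵀ = C) :
    M.rhsA γ b C + M.rhsB γ b C ⬝ᵥ z + z ⬝ᵥ M.rhsC γ C *ᵥ z
      + (M.theta - z) ⬝ᵥ M.delta *ᵥ (b + (2 : ℝ) • C *ᵥ z)
      + 1 / 2 * (M.Sigma3 * ((2 : ℝ) • C
          + Matrix.vecMulVec (b + (2 : ℝ) • C *ᵥ z) (b + (2 : ℝ) • C *ᵥ z))).trace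
      + M.r * γ
      + γ / (1 - γ) / 2 *
        ((M.muEx - M.delta *ᵥ z + M.Sigma2 *ᵥ (b + (2 : ℝ) • C *ᵥ z)) ⬝ᵥ M.Sigma1⁻¹ *ᵥ
          (M.muEx - M.delta *ᵥ z + M.Sigma2 *ᵥ (b + (2 : ℝ) • C *ᵥ z))) = 0 := by
  have htr : (M.Sigma3 * ((2 : ℝ) • C
      + Matrix.vecMulVec (b + (2 : ℝ) • C *ᵥ z) (b + (2 : ℝ) • C *ᵥ z))).trace
      = 2 * (M.Sigma2 * C).trace
        + (b + (2 : ℝ) • C *ᵥ z) ⬝ᵥ M.Sigma2 *ᵥ (b + (2 : ℝ) • C *ᵥ z) := by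
    rw [Sigma3_eq_Sigma2, Matrix.mul_add, Matrix.trace_add, Matrix.mul_smul, Matrix.trace_smul,
      Matrix.mul_vecMulVec, Matrix.trace_vecMulVec, smul_eq_mul, dotProduct_comm]
  rw [rhsA_eq, rhsB_dotProduct M γ b z hC, quadForm_rhsC M γ z hC, htr]
  -- Now `x` can be treated as a free vector. Once every symmetric form is written in one order, the
  -- identity is polynomial in the scalar products that remain.
  set x := C *ᵥ z
  have hs := dotProduct_mulVec_comm_of_transpose_eq M.Sigma1_inv_transpose
  have h2 := dotProduct_mulVec_comm_of_transpose_eq M.Sigma2_transpose x b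
  have hz : ∀ y, z ⬝ᵥ M.delta *ᵥ y = y ⬝ᵥ M.delta *ᵥ z :=
    dotProduct_mulVec_comm_of_transpose_eq M.delta_transpose z
  simp only [dotProduct_riccatiR_mulVec, dotProduct_riccatiA_mulVec, Matrix.mulVec_add,
    Matrix.mulVec_sub, Matrix.mulVec_smul, add_dotProduct, sub_dotProduct, dotProduct_add,
    dotProduct_sub, smul_dotProduct, dotProduct_smul, smul_eq_mul, hz,
    h2, hs (M.Sigma2 *ᵥ x) (M.Sigma2 *ᵥ b), hs (M.Sigma2 *ᵥ x) M.muEx,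
    hs (M.Sigma2 *ᵥ b) M.muEx, hs (M.delta *ᵥ z) M.muEx, hs (M.Sigma2 *ᵥ b) (M.delta *ᵥ z),
    hs (M.Sigma2 *ᵥ x) (M.delta *ᵥ z)]
  ring

/-- Each term of the equation carries the factor `w ^ γ E`, with `E` the exponential in `u`. The
expression under the supremum is this positive factor times `π ⬝ᵥ h - (1 - γ) / 2 * (π ⬝ᵥ Σ₁ π)`,
where `h = μ - δ z + Σ₂ (b + 2 C z)`. Symmetry of `C` makes `b + 2 C z` the gradient of the
exponent. -/
theorem SolvesODE.solvesHJB {γ T : ℝ} (hγ : γ < 0) {a : ℝ → ℝ} {b : ℝ → Fin d → ℝ}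
    {C : ℝ → Matrix (Fin d) (Fin d) ℝ} (h : M.SolvesODE γ T a b C)
    (hC : ∀ t ≤ T, (C t)ᵀ = C t) : M.SolvesHJB γ T (expQuadValue γ a b C) := by
  have htime : ∀ w, ∀ z, ∀ t ≤ T, HasDerivWithinAt (fun s => expQuadValue γ a b C s w z)
      (expQuadValue γ a b C t w z * (M.rhsA γ (b t) (C t) + M.rhsB γ (b t) (C t) ⬝ᵥ z
        + z ⬝ᵥ M.rhsC γ (C t) *ᵥ z)) (Iic T) t := fun w z t ht => by
    have hb : HasDerivWithinAt (fun s => b s ⬝ᵥ z) (M.rhsB γ (b t) (C t) ⬝ᵥ z) (Iic T) t := by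
      unfold dotProduct
      exact HasDerivWithinAt.fun_sum fun i _ =>
        (hasDerivWithinAt_pi.1 (h.deriv_b t ht) i).mul_const (z i)
    have hCz : HasDerivWithinAt (fun s => z ⬝ᵥ C s *ᵥ z) (z ⬝ᵥ M.rhsC γ (C t) *ᵥ z)
        (Iic T) t := by
      unfold dotProduct Matrix.mulVec dotProduct
      exact HasDerivWithinAt.fun_sum fun i _ => (HasDerivWithinAt.fun_sum fun j _ =>
        (h.deriv_C t ht i j).mul_const (z j)).const_mul (z i)
    refine ((((h.deriv_a t ht).add hb).add hCz).exp.const_mul (1 / γ * w ^ γ)).congr_deriv ?_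
    simp only [expQuadValue]
    simp only [Pi.add_apply]
    ring
  refine ⟨fun w _ z t ht => (htime w z t ht).differentiableWithinAt, fun t _ => ?_, ?_, ?_⟩
  · unfold expQuadValue
    refine ContDiffOn.mul (contDiffOn_const.mul ?_) ?_
    · exact contDiffOn_fst.rpow_const_of_ne fun p hp => (mem_Ioi.1 hp.1).ne'
    · exact ((contDiff_dotProduct_mulVec (b t) (C t) (a t)).comp contDiff_snd).exp.contDiffOn
  · intro t ht w hw z
    set g := b t + (2 : ℝ) • C t *ᵥ z with hg
    set E := Real.exp (a t + b t ⬝ᵥ z + z ⬝ᵥ C t *ᵥ z) with hE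
    have hpos : 0 < w ^ γ * E := by positivity
    have e1 : deriv (fun x => expQuadValue γ a b C t x z) w = w ^ (γ - 1) * E :=
      deriv_rpow_mul hγ.ne _ hw
    have e2 : iteratedDeriv 2 (fun x => expQuadValue γ a b C t x z) w
        = (γ - 1) * w ^ (γ - 2) * E := iteratedDeriv_two_rpow_mul hγ.ne _ hw
    have e3 : gradZ (fun y => deriv (fun x => expQuadValue γ a b C t x y) w) z
        = (w ^ (γ - 1) * E) • g := by
      have : (fun y => deriv (fun x => expQuadValue γ a b C t x y) w)
          = fun y => w ^ (γ - 1) * Real.exp (a t + b t ⬝ᵥ y + y ⬝ᵥ C t *ᵥ y) :=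
        funext fun y => deriv_rpow_mul hγ.ne _ hw
      rw [this, gradZ_exp_quadratic (hC t ht)]
    have e4 : gradZ (fun y => expQuadValue γ a b C t w y) z = (1 / γ * w ^ γ * E) • g :=
      gradZ_exp_quadratic (hC t ht) _ _ _ _
    have e5 : hessZ (fun y => expQuadValue γ a b C t w y) z
        = (1 / γ * w ^ γ * E) • ((2 : ℝ) • C t + Matrix.vecMulVec g g) :=
      hessZ_exp_quadratic (hC t ht) _ _ _ _
    have hw1 : w * w ^ (γ - 1) = w ^ γ := by
      rw [Real.rpow_sub_one hw.ne']; field_simp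
    have hw2 : w ^ 2 * w ^ (γ - 2) = w ^ γ := by
      rw [← Real.rpow_natCast, ← Real.rpow_add hw]; norm_num
    rw [e1, e2, e3, e4, e5, (htime w z t ht).derivWithin (uniqueDiffOn_Iic T t ht)]
    have hmax := isGreatest_concave_quadratic M.Sigma1_posDef (show 0 < 1 - γ by linarith)
      (M.muEx - M.delta *ᵥ z + M.Sigma2 *ᵥ g)
    have hred := M.reduced_hjb γ (b t) z (hC t ht)
    rw [← hg] at hred
    have hval : -(expQuadValue γ a b C t w z * (M.rhsA γ (b t) (C t) + M.rhsB γ (b t) (C t) ⬝ᵥ z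
          + z ⬝ᵥ M.rhsC γ (C t) *ᵥ z))
        - (M.theta - z) ⬝ᵥ M.delta *ᵥ ((1 / γ * w ^ γ * E) • g)
        - 1 / 2 * (M.Sigma3 * ((1 / γ * w ^ γ * E) •
          ((2 : ℝ) • C t + Matrix.vecMulVec g g))).trace
        - M.r * w * (w ^ (γ - 1) * E)
        = w ^ γ * E * (1 / (2 * (1 - γ)) * ((M.muEx - M.delta *ᵥ z + M.Sigma2 *ᵥ g) ⬝ᵥ
          M.Sigma1⁻¹ *ᵥ (M.muEx - M.delta *ᵥ z + M.Sigma2 *ᵥ g))) := by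
      have hu : expQuadValue γ a b C t w z = 1 / γ * w ^ γ * E := rfl
      rw [hu, Matrix.mulVec_smul, dotProduct_smul, Matrix.mul_smul, Matrix.trace_smul,
        show M.r * w * (w ^ (γ - 1) * E) = M.r * (w ^ γ * E) by rw [← hw1]; ring, smul_eq_mul,
        smul_eq_mul]
      have hγ0 : γ ≠ 0 := hγ.ne
      have h1γ : 1 - γ ≠ 0 := by linarith
      -- `reduced_hjb` is normalised by `u = w ^ γ E / γ`, the maximum by `w ^ γ E`; the factor `1 /
      -- γ` reconciles them.
      have hk : 1 / (2 * (1 - γ)) = 1 / γ * (γ / (1 - γ) / 2) := by field_simp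
      have hr : M.r * (w ^ γ * E) = 1 / γ * w ^ γ * E * (M.r * γ) := by field_simp
      rw [hk, hr]
      linear_combination (-(1 / γ * w ^ γ * E)) * hred
    rw [hval]
    have hfun : ∀ π : Fin d → ℝ, π ⬝ᵥ (M.muEx - M.delta *ᵥ z) * (w * (w ^ (γ - 1) * E))
        + π ⬝ᵥ M.Sigma2 *ᵥ ((w ^ (γ - 1) * E) • g) * w
        + 1 / 2 * (π ⬝ᵥ M.Sigma1 *ᵥ π) * w ^ 2 * ((γ - 1) * w ^ (γ - 2) * E)
        = w ^ γ * E * (π ⬝ᵥ (M.muEx - M.delta *ᵥ z + M.Sigma2 *ᵥ g)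
          - (1 - γ) / 2 * (π ⬝ᵥ M.Sigma1 *ᵥ π)) := fun π => by
      rw [Matrix.mulVec_smul, dotProduct_smul, dotProduct_add, smul_eq_mul]
      linear_combination (π ⬝ᵥ (M.muEx - M.delta *ᵥ z) * E + π ⬝ᵥ M.Sigma2 *ᵥ g * E) * hw1
        + (1 / 2 * (π ⬝ᵥ M.Sigma1 *ᵥ π) * (γ - 1) * E) * hw2
    simp only [hfun]
    refine IsGreatest.isLUB ⟨?_, ?_⟩
    · obtain ⟨π, hπ⟩ := hmax.1
      exact ⟨π, congrArg (fun x => w ^ γ * E * x) hπ⟩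
    · rintro _ ⟨π, rfl⟩
      exact mul_le_mul_of_nonneg_left (hmax.2 ⟨π, rfl⟩) hpos.le
  · intro w _ z
    simp [expQuadValue, powerUtility, h.terminal_a, h.terminal_b, h.terminal_C]

end CointegratedMarket

end

/-! ### The certainty equivalent and the conclusion -/

theorem powerUtilityInv_powerUtility {γ : ℝ} (hγ : γ ≠ 0) {w : ℝ} (hw : 0 < w) :
    powerUtilityInv γ (powerUtility γ w) = w := by
  have hinj : InjOn (powerUtility γ) (Ioi 0) := fun x hx y hy hxy => by
    have h : x ^ γ = y ^ γ := mul_left_cancel₀ (one_div_ne_zero hγ) hxy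
    have h2 := congrArg (fun v : ℝ => v ^ γ⁻¹) h
    simpa [Real.rpow_rpow_inv (le_of_lt hx) hγ, Real.rpow_rpow_inv (le_of_lt hy) hγ] using h2
  exact hinj.leftInvOn_invFunOn hw

/-- `u` is the utility of the wealth `w * exp (exponent / γ)`, because the power `γ` undoes the
division. -/
theorem log_powerUtilityInv_expQuadValue {d : ℕ} {γ : ℝ} (hγ : γ ≠ 0) (a : ℝ → ℝ)
    (b : ℝ → Fin d → ℝ) (C : ℝ → Matrix (Fin d) (Fin d) ℝ) (t : ℝ) {w : ℝ} (hw : 0 < w)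
    (z : Fin d → ℝ) :
    Real.log (powerUtilityInv γ (expQuadValue γ a b C t w z))
      = Real.log w + (a t + b t ⬝ᵥ z + z ⬝ᵥ C t *ᵥ z) / γ := by
  have h : expQuadValue γ a b C t w z
      = powerUtility γ (w * Real.exp ((a t + b t ⬝ᵥ z + z ⬝ᵥ C t *ᵥ z) / γ)) := by
    rw [powerUtility, expQuadValue, Real.mul_rpow hw.le (Real.exp_pos _).le, ← Real.exp_mul,
      div_mul_cancel₀ _ hγ, mul_assoc]
  rw [h, powerUtilityInv_powerUtility hγ (by positivity),
    Real.log_mul hw.ne' (Real.exp_pos _).ne', Real.log_exp]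

theorem CointegratedMarket.tendsto_rhsA {d m : ℕ} (M : CointegratedMarket d m) (γ : ℝ)
    {l : Filter ℝ} {b : ℝ → Fin d → ℝ} {C : ℝ → Matrix (Fin d) (Fin d) ℝ} {c : Fin d → ℝ}
    {Y : Matrix (Fin d) (Fin d) ℝ} (hb : Tendsto b l (𝓝 c)) (hC : Tendsto C l (𝓝 Y)) :
    Tendsto (fun t => M.rhsA γ (b t) (C t)) l (𝓝 (M.rhsA γ c Y)) := by
  have h1 : Tendsto (fun p : (Fin d → ℝ) × Matrix (Fin d) (Fin d) ℝ => M.rhsA γ p.1 p.2)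
      (𝓝 (c, Y)) (𝓝 (M.rhsA γ c Y)) := (M.continuous_rhsA γ).tendsto (c, Y)
  have h2 : Tendsto (fun t => (b t, C t)) l (𝓝 (c, Y)) := hb.prodMk_nhds hC
  have h3 := h1.comp h2
  simp only [Function.comp_def] at h3
  exact h3

theorem mainTheorem3 {d m : ℕ} (M : CointegratedMarket d m) (γ : ℝ) (hγ : γ < 0) :
    ∃ (a : ℝ → ℝ → ℝ) (b : ℝ → ℝ → Fin d → ℝ) (C : ℝ → ℝ → Matrix (Fin d) (Fin d) ℝ),
      -- for every horizon `T`, the unique solution on `(-∞, T]`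
      (∀ T, M.SolvesODE γ T (a T) (b T) (C T) ∧
        ∀ a' b' C', M.SolvesODE γ T a' b' C' →
          EqOn a' (a T) (Iic T) ∧ EqOn b' (b T) (Iic T) ∧ EqOn C' (C T) (Iic T)) ∧
      -- its value function solves the Hamilton-Jacobi-Bellman equation
      (∀ T, M.SolvesHJB γ T (expQuadValue γ (a T) (b T) (C T))) ∧
      ∃ (bBar : Fin d → ℝ) (CBar : Matrix (Fin d) (Fin d) ℝ),
        (∀ T, Tendsto (b T) atBot (𝓝 bBar) ∧ Tendsto (C T) atBot (𝓝 CBar) ∧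
          Tendsto (fun t => M.rhsA γ (b T t) (C T t)) atBot (𝓝 (M.rhsA γ bBar CBar)) ∧
          -- asymptotic linearity of `a`
          Tendsto (fun t => a T t / (T - t)) atBot (𝓝 (-M.rhsA γ bBar CBar))) ∧
        -- growth rate of the certainty equivalent, as `t → -∞` and as `T → ∞`
        (∀ w > 0, ∀ z : Fin d → ℝ,
          (∀ T, Tendsto (fun t => Real.log (powerUtilityInv γ
              (expQuadValue γ (a T) (b T) (C T) t w z)) / (T - t))
            atBot (𝓝 (-M.rhsA γ bBar CBar / γ))) ∧
          (∀ t, Tendsto (fun T => Real.log (powerUtilityInv γ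
              (expQuadValue γ (a T) (b T) (C T) t w z)) / (T - t))
            atTop (𝓝 (-M.rhsA γ bBar CBar / γ)))) := by
  have hR := M.riccatiR_posSemidef hγ
  obtain ⟨K, hK⟩ := M.exists_stabilizing_feedback hγ
  obtain ⟨X, b, hX0, hb0, hXt, hX, hb, ⟨Y, hY⟩, ⟨c, hc⟩⟩ :=
    exists_convergent_riccati_flow hR (M.riccatiQ_posDef hγ) M.speed_pos hK (M.sourceE γ)
      (M.sourceF γ)
  have hXc : ContinuousOn X (Ici 0) := continuousOn_pi.2 fun i => continuousOn_pi.2 fun j t ht =>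
    (hX t ht i j).continuousAt.continuousWithinAt
  have hbc : ContinuousOn b (Ici 0) := fun t ht => (hb t ht).continuousAt.continuousWithinAt
  have hLc : ContinuousOn (fun t => -M.rhsA γ (b t) (-X t)) (Ici 0) :=
    ((M.continuous_rhsA γ).comp_continuousOn (hbc.prodMk hXc.neg)).neg
  obtain ⟨a, ha0, ha⟩ := exists_primitive_of_continuousOn_Ici hLc
  have hL : Tendsto (fun t => M.rhsA γ (b t) (-X t)) atTop (𝓝 (M.rhsA γ c (-Y))) :=
    M.tendsto_rhsA γ hc hY.neg
  have ha_lim := tendsto_div_of_tendsto_deriv ha hL.neg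
  have hsol : ∀ T, M.SolvesODE γ T (fun t => a (T - t)) (fun t => b (T - t))
      (fun t => -X (T - t)) := fun T =>
    M.solvesODE_of_riccati_flow hX0 hb0 ha0 hX hb hXt (transpose_eq_of_posSemidef hR) ha
  have hbot : ∀ T : ℝ, Tendsto (fun t => T - t) atBot atTop := fun T =>
    tendsto_atTop_add_const_left _ T tendsto_neg_atBot_atTop
  have htop : ∀ t : ℝ, Tendsto (fun T => T - t) atTop atTop := fun t =>
    tendsto_atTop_add_const_right _ (-t) tendsto_id
  refine ⟨fun T t => a (T - t), fun T t => b (T - t), fun T t => -X (T - t),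
    fun T => ⟨hsol T, fun a' b' C' h' => CointegratedMarket.SolvesODE.unique M (hsol T) h'⟩,
    fun T => CointegratedMarket.SolvesODE.solvesHJB M hγ (hsol T) fun t ht => ?_, c, -Y,
    fun T => ⟨hc.comp (hbot T), hY.neg.comp (hbot T), hL.comp (hbot T), ha_lim.comp (hbot T)⟩,
    fun w hw z => ?_⟩
  · rw [Matrix.transpose_neg, hXt _ (sub_nonneg.2 ht)]
  -- Both limits, `t → -∞` and `T → ∞`, are this one in `τ = T - t`. The terms in `w`, `b` and `X`
  -- converge and vanish after division by `τ`; only `a` contributes.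
  have hrate : Tendsto (fun τ => (Real.log w + (a τ + b τ ⬝ᵥ z + z ⬝ᵥ (-X τ) *ᵥ z) / γ) / τ)
      atTop (𝓝 (-M.rhsA γ c (-Y) / γ)) := by
    have hcont : Continuous fun p : (Fin d → ℝ) × Matrix (Fin d) (Fin d) ℝ =>
        Real.log w + (p.1 ⬝ᵥ z + z ⬝ᵥ p.2 *ᵥ z) / γ := by fun_prop
    have h1 := (((hcont.tendsto (c, -Y)).comp (hc.prodMk_nhds hY.neg)).div_atTop tendsto_id).add
      (ha_lim.div_const γ)
    rw [zero_add] at h1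
    refine h1.congr fun τ => ?_
    simp only [Function.comp_apply, id_eq]
    ring
  refine ⟨fun T => (hrate.comp (hbot T)).congr fun t => ?_,
    fun t => (hrate.comp (htop t)).congr fun T => ?_⟩
  all_goals rw [log_powerUtilityInv_expQuadValue hγ.ne _ _ _ _ hw, Function.comp_apply]
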